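/- **Drawings and diagrams.** A *drawing* of a braided band diagram is a vertical stack of finitely many (possibly zero) horizontal layers, read from top to bottom, starting with a single band at the top and ending with a single band at the bottom. Bands are numbered from the left. In each layer exactly one of the following happens and all other bands run straight down: the $i$-th band splits into two neighbouring bands ($\lambda_i$); the $i$-th and $(i+1)$-st bands merge into one ($\mu_i$); or the $i$-th and $(i+1)$-st bands cross, the band going from left to right passing over ($\sigma_i$) or under ($\sigma_i^{-1}$) the other. Bands are never twisted. A *braided band diagram* is a drawing up to ambient isotopy not twisting bands, i.e. up to the equivalence relation on drawings generated by the following replacements, which may be applied at any place in a drawing: - interchanging the heights of two pieces that lie side by side; - $\sigma_i\sigma_i^{-1}=\sigma_i^{-1}\sigma_i=\text{(nothing)}$ and $\sigma_i\sigma_{i+1}\sigma_i=\sigma_{i+1}\sigma_i\sigma_{i+1}$ (and the same with all crossings inverted); - pushing a split or a merge across a neighbouring band, for $\varepsilon=\pm1$ (words are read from top to bottom): $\sigma_i^{\varepsilon}\lambda_{i+1}=\lambda_i\sigma_{i+1}^{\varepsilon}\sigma_i^{\varepsilon}$, $\ \sigma_i^{\varepsilon}\lambda_i=\lambda_{i+1}\sigma_i^{\varepsilon}\sigma_{i+1}^{\varepsilon}$,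 $\ \mu_i\sigma_i^{\varepsilon}=\sigma_{i+1}^{\varepsilon}\sigma_i^{\varepsilon}\mu_{i+1}$, $\ \mu_{i+1}\sigma_i^{\varepsilon}=\sigma_i^{\varepsilon}\sigma_{i+1}^{\varepsilon}\mu_i$. **Moves.** A *forward move* $D\to E$ takes a drawing of the diagram $D$ and either replaces a split immediately followed by the merge of the two resulting bands ($\lambda_i\mu_i$, an *eye*) by one straight band, or replaces a merge immediately followed by a split of the resulting band ($\mu_i\lambda_i$, a *joint*) by two parallel straight bands; the result is a drawing of $E$. A diagram is *reduced* if it admits no forward move. Two diagrams are *equivalent* if one can be transformed into the other by a finite sequence of moves, each performed forward or backward. **Proposition.** Every equivalence class of braided band diagrams contains a unique reduced diagram, and this diagram can be obtained from any diagram in the class by a finite (possibly empty) sequence of forward moves. -/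

import Mathlib

namespace BraidedBand

/-- The elementary pieces of a braided band diagram, read from top to bottom: a band splits into two,
two neighbouring bands merge into one, or two neighbouring bands cross without twisting.
In `cross true` the band going from left to right passes over the other one, in `cross false` it
passes under. -/
inductive Piece : Type
  | split : Piece
  | merge : Piece
  | cross (e : Bool) : Piece

/-- The number of bands entering a piece at its top. -/
def Piece.inp : Piece → ℕ
  | .split => 1
  | .merge => 2
  | .cross _ => 2

/-- The number of bands leaving a piece at its bottom. -/
def Piece.out : Piece → ℕ
  | .split => 2
  | .merge => 1
  | .cross _ => 2

/-- A horizontal layer of a drawing: one elementary piece, with `pos` vertical bands to its left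
(and some number of vertical bands to its right, which is determined by the total width). -/
structure Layer : Type where
  piece : Piece
  pos : ℕ

/-- The band at position `i` (counted from `0`, from the left) splits. -/
abbrev split (i : ℕ) : Layer := ⟨.split, i⟩

/-- The bands at positions `i` and `i + 1` merge. -/
abbrev merge (i : ℕ) : Layer := ⟨.merge, i⟩

/-- The bands at positions `i` and `i + 1` cross. -/
abbrev cross (e : Bool) (i : ℕ) : Layer := ⟨.cross e, i⟩

/-- `Stacks n w m`: the layers in `w`, stacked from top to bottom, form a drawing which has `n` bands
at the top and `m` bands at the bottom. -/
def Stacks : ℕ → List Layer → ℕ → Prop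
  | n, [], m => n = m
  | n, x :: w, m =>
      ∃ b : ℕ, n = x.pos + x.piece.inp + b ∧ Stacks (x.pos + x.piece.out + b) w m

/-- A drawing of a braided band diagram (in general position): it starts with a single band at the
top and ends with a single band at the bottom. -/
def Drawing : Type := {w : List Layer // Stacks 1 w 1}

/-- The elementary isotopies of drawings that do not twist bands: pieces beside each other change
their relative height; the Reidemeister moves of types two and three for braids; and a split or a
merge is pushed over or under a band running beside it. These are the defining relations of the free
strict braided monoidal category on one object and two generating morphisms `1 ⟶ 2` and `2 ⟶ 1`. -/
inductive LocalIsotopy : List Layer → List Layer → Prop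
  | height (x y : Piece) (i d : ℕ) :
      LocalIsotopy [⟨x, i⟩, ⟨y, i + x.out + d⟩] [⟨y, i + x.inp + d⟩, ⟨x, i⟩]
  | cancel (e : Bool) (i : ℕ) :
      LocalIsotopy [cross e i, cross (!e) i] []
  | braid (e : Bool) (i : ℕ) :
      LocalIsotopy [cross e i, cross e (i + 1), cross e i]
        [cross e (i + 1), cross e i, cross e (i + 1)]
  | splitRight (e : Bool) (i : ℕ) :
      LocalIsotopy [cross e i, split (i + 1)] [split i, cross e (i + 1), cross e i]
  | splitLeft (e : Bool) (i : ℕ) :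
      LocalIsotopy [cross e i, split i] [split (i + 1), cross e i, cross e (i + 1)]
  | mergeRight (e : Bool) (i : ℕ) :
      LocalIsotopy [merge i, cross e i] [cross e (i + 1), cross e i, merge (i + 1)]
  | mergeLeft (e : Bool) (i : ℕ) :
      LocalIsotopy [merge (i + 1), cross e i] [cross e i, cross e (i + 1), merge i]

/-- Two drawings differ by one elementary isotopy, applied anywhere in the drawing. -/
def Drawing.IsotopyStep (v w : Drawing) : Prop :=
  ∃ top l r bot : List Layer, LocalIsotopy l r ∧ v.1 = top ++ l ++ bot ∧ w.1 = top ++ r ++ bot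

/-- Isotopy of drawings: the equivalence relation generated by the elementary isotopies. -/
def Drawing.isotopy : Setoid Drawing := Relation.EqvGen.setoid Drawing.IsotopyStep

/-- Braided band diagrams: drawings up to isotopy. -/
def BraidedBandDiagram : Type := Quotient Drawing.isotopy

/-- The braided band diagram shown by a drawing. -/
def Drawing.toDiagram (w : Drawing) : BraidedBandDiagram := Quotient.mk Drawing.isotopy w

/-- The subdiagrams that are replaced by untwisted parallel bands in a forward move: an eye
(a split directly followed by the merge of the two resulting bands) is replaced by one band, a joint
(a merge directly followed by a split of the resulting band) by two bands. -/
inductive Redex : List Layer → Prop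
  | eye (i : ℕ) : Redex [split i, merge i]
  | joint (i : ℕ) : Redex [merge i, split i]

namespace BraidedBandDiagram

/-- One forward move (an eye removal or a joint removal), performed in some drawing of `D`. -/
def ForwardMove (D E : BraidedBandDiagram) : Prop :=
  ∃ (v w : Drawing) (top l bot : List Layer), Redex l ∧ v.1 = top ++ l ++ bot ∧ w.1 = top ++ bot ∧
    v.toDiagram = D ∧ w.toDiagram = E

/-- A diagram is reduced if it admits no forward move. -/
def IsReduced (D : BraidedBandDiagram) : Prop := ∀ E, ¬ ForwardMove D E

/-- Equivalence: a finite sequence of forward and backward moves. -/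
def equivalence : Setoid BraidedBandDiagram := Relation.EqvGen.setoid ForwardMove

/-- `D` is transformed into `E` by a finite sequence of forward moves. -/
def ReducesTo : BraidedBandDiagram → BraidedBandDiagram → Prop := Relation.ReflTransGen ForwardMove

end BraidedBandDiagram

end BraidedBand

namespace BraidedBand

/-! Forward moves form a terminating rewriting relation with a one-step diamond property, so the
proposition follows by Church–Rosser. Termination is easy: the number of splits and merges is an
isotopy invariant, and each move lowers it by two.

The difficulty in the diamond is that the two moves from a diagram may be visible only in different
drawings `v` and `v'` of it, and an isotopy can tear an eye or a joint apart. The remedy is to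
describe a move without reference to a drawing. Give each band between two vertices (splits and
merges) its own label, keeping it through crossings, and assign a width to each label. Expanding a
drawing replaces a band of width `n` by `n` parallel bands, a crossing by a crossing of cables, and
a vertex by a split, a merge or nothing, according to its total widths above and below. Removing an
eye means giving its left band width 0; removing a joint means giving its middle band width 2; all
other widths are 1.

Labels are carried along every elementary isotopy, and isotopic labelled drawings have isotopic
expansions, since splits, merges and crossings slide through cable crossings (`LIso.expand`,
`lift_of_toDiagram_eq`). So both moves are changes of width on one and the same labelled diagram. If
they change the same label, their results agree. Otherwise changing both widths gives a common
target: the second change is made in the drawing where its eye or joint is visible, and there it is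
either one forward move or has no effect, the latter when the two moves overlap
(`expand_update_eq_or_redex`, `ForwardMove.diamond`). -/

/-! ### Stacking drawings and adding bands at the sides. -/

theorem stacks_append {n m : ℕ} {v w : List Layer} :
    Stacks n (v ++ w) m ↔ ∃ k, Stacks n v k ∧ Stacks k w m := by
  induction v generalizing n with
  | nil => simp [Stacks]
  | cons x v ih => simp only [List.cons_append, Stacks, ih]; grind

theorem Stacks.append {n k m : ℕ} {v w : List Layer} (hv : Stacks n v k) (hw : Stacks k w m) :
    Stacks n (v ++ w) m :=
  stacks_append.2 ⟨k, hv, hw⟩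

theorem Stacks.cast {n m n' m' : ℕ} {w : List Layer} (h : Stacks n w m) (hn : n' = n := by omega)
    (hm : m' = m := by omega) : Stacks n' w m' := by
  subst hn hm
  exact h

theorem Stacks.unique {n m m' : ℕ} {w : List Layer} (h : Stacks n w m) (h' : Stacks n w m') :
    m = m' := by
  induction w generalizing n with
  | nil => exact h.symm.trans h'
  | cons x w ih =>
    obtain ⟨b, hb, h⟩ := h
    obtain ⟨b', hb', h'⟩ := h'
    obtain rfl : b = b' := by omega
    exact ih h h'

/-- The drawing `w` with `i` additional bands on its left. -/
def shift (i : ℕ) (w : List Layer) : List Layer :=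
  w.map fun x => ⟨x.piece, i + x.pos⟩

@[simp] theorem shift_nil (i : ℕ) : shift i [] = [] := rfl

@[simp] theorem shift_cons (i : ℕ) (x : Layer) (w : List Layer) :
    shift i (x :: w) = ⟨x.piece, i + x.pos⟩ :: shift i w := rfl

@[simp] theorem shift_append (i : ℕ) (v w : List Layer) :
    shift i (v ++ w) = shift i v ++ shift i w :=
  List.map_append

@[simp] theorem shift_shift (i j : ℕ) (w : List Layer) :
    shift i (shift j w) = shift (i + j) w := by
  simp [shift, add_assoc]

@[simp] theorem shift_zero (w : List Layer) : shift 0 w = w := by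
  simp [shift]

theorem Stacks.shift {n m : ℕ} {w : List Layer} (h : Stacks n w m) (i : ℕ) :
    Stacks (i + n) (shift i w) (i + m) := by
  induction w generalizing n with
  | nil => exact congrArg (i + ·) h
  | cons x w ih =>
    obtain ⟨b, rfl, h⟩ := h
    refine ⟨b, by simp only; omega, ?_⟩
    have := ih h
    rwa [show i + (x.pos + x.piece.out + b) = i + x.pos + x.piece.out + b by omega] at this

/-- A layer records only the bands to its left, so extra bands on the right leave the word
unchanged. -/
theorem Stacks.pad {n m : ℕ} {w : List Layer} (h : Stacks n w m) (j : ℕ) :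
    Stacks (n + j) w (m + j) := by
  induction w generalizing n with
  | nil => exact congrArg (· + j) h
  | cons x w ih =>
    obtain ⟨b, rfl, h⟩ := h
    refine ⟨b + j, by omega, ?_⟩
    convert ih h using 1
    omega

/-! ### Isotopy of partial drawings of arbitrary width. -/

/-- Isotopy of partial drawings with `n` bands at the top and `m` bands at the bottom. -/
inductive Iso : ℕ → ℕ → List Layer → List Layer → Prop
  | ofLocal {n m : ℕ} {l r : List Layer} :
      LocalIsotopy l r → Stacks n l m → Stacks n r m → Iso n m l r
  | refl {n m : ℕ} {w : List Layer} : Stacks n w m → Iso n m w w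
  | symm {n m : ℕ} {v w : List Layer} : Iso n m v w → Iso n m w v
  | trans {n m : ℕ} {v w x : List Layer} : Iso n m v w → Iso n m w x → Iso n m v x
  | comp {n k m : ℕ} {v v' w w' : List Layer} :
      Iso n k v v' → Iso k m w w' → Iso n m (v ++ w) (v' ++ w')

namespace Iso

theorem stacks_both {n m : ℕ} {v w : List Layer} (h : Iso n m v w) :
    Stacks n v m ∧ Stacks n w m := by
  induction h with
  | ofLocal _ hl hr => exact ⟨hl, hr⟩
  | refl h => exact ⟨h, h⟩
  | symm _ ih => exact ih.symm
  | trans _ _ ih ih' => exact ⟨ih.1, ih'.2⟩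
  | comp _ _ ih ih' => exact ⟨ih.1.append ih'.1, ih.2.append ih'.2⟩

theorem cast {n m n' m' : ℕ} {v w v' w' : List Layer} (h : Iso n m v w) (hn : n' = n := by omega)
    (hm : m' = m := by omega) (hv : v' = v := by simp) (hw : w' = w := by simp) :
    Iso n' m' v' w' := by
  subst hn hm hv hw
  exact h

theorem _root_.BraidedBand.LocalIsotopy.shift {l r : List Layer} (h : LocalIsotopy l r) (i : ℕ) :
    LocalIsotopy (shift i l) (shift i r) := by
  cases h with
  | height x y j d =>
    simpa [add_assoc] using LocalIsotopy.height x y (i + j) d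
  | cancel e j => exact .cancel e (i + j)
  | braid e j => exact .braid e (i + j)
  | splitRight e j => exact .splitRight e (i + j)
  | splitLeft e j => exact .splitLeft e (i + j)
  | mergeRight e j => exact .mergeRight e (i + j)
  | mergeLeft e j => exact .mergeLeft e (i + j)

theorem shift {n m : ℕ} {v w : List Layer} (h : Iso n m v w) (i : ℕ) :
    Iso (i + n) (i + m) (shift i v) (shift i w) := by
  induction h with
  | ofLocal h hl hr => exact .ofLocal (h.shift i) (hl.shift i) (hr.shift i)
  | refl h => exact .refl (h.shift i)
  | symm _ ih => exact ih.symm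
  | trans _ _ ih ih' => exact ih.trans ih'
  | comp _ _ ih ih' => simpa only [shift_append] using ih.comp ih'

theorem pad {n m : ℕ} {v w : List Layer} (h : Iso n m v w) (j : ℕ) :
    Iso (n + j) (m + j) v w := by
  induction h with
  | ofLocal h hl hr => exact .ofLocal h (hl.pad j) (hr.pad j)
  | refl h => exact .refl (h.pad j)
  | symm _ ih => exact ih.symm
  | trans _ _ ih ih' => exact ih.trans ih'
  | comp _ _ ih ih' => exact ih.comp ih'

theorem comp_left {n k m : ℕ} {v w w' : List Layer} (hv : Stacks n v k) (h : Iso k m w w') :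
    Iso n m (v ++ w) (v ++ w') :=
  (Iso.refl hv).comp h

theorem comp_right {n k m : ℕ} {v v' w : List Layer} (h : Iso n k v v') (hw : Stacks k w m) :
    Iso n m (v ++ w) (v' ++ w) :=
  h.comp (Iso.refl hw)

/-- An isotopy may be performed inside a larger drawing. -/
theorem step {n m N M : ℕ} {v w x y : List Layer} (H : Iso N M x y) (h : Iso n m v w) (i j : ℕ)
    (top bot : List Layer) (ht : Stacks N top (i + n + j))
    (hy : y = top ++ (BraidedBand.shift i v ++ bot)) :
    Iso N M x (top ++ (BraidedBand.shift i w ++ bot)) := by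
  subst hy
  obtain ⟨k, hk, hb⟩ := stacks_append.1 H.stacks_both.2
  obtain rfl := hk.unique ht
  obtain ⟨k, hk, hb⟩ := stacks_append.1 hb
  obtain rfl := hk.unique ((h.stacks_both.1.shift i).pad j)
  exact H.trans ((((h.shift i).pad j).comp_right hb).comp_left ht)

theorem congr_right {n m : ℕ} {v w w' : List Layer} (h : Iso n m v w) (hw : w = w') :
    Iso n m v w' :=
  hw ▸ h

theorem interchange_layer (x : Layer) {n m p q : ℕ} {w : List Layer} (hx : Stacks n [x] m)
    (hw : Stacks p w q) :
    Iso (n + p) (m + q) (x :: BraidedBand.shift m w) (BraidedBand.shift n w ++ [x]) := by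
  induction w generalizing p with
  | nil =>
    obtain rfl : p = q := hw
    exact .refl (hx.pad p)
  | cons y w ih =>
    obtain ⟨x, i⟩ := x
    obtain ⟨y, j⟩ := y
    obtain ⟨b, rfl, rfl⟩ := id hx
    obtain ⟨c, rfl, hw⟩ := hw
    simp only at *
    have h1 : Iso (i + x.inp + b + (j + y.inp + c)) (i + x.out + b + (j + y.out + c))
        [⟨x, i⟩, ⟨y, i + x.out + b + j⟩] [⟨y, i + x.inp + b + j⟩, ⟨x, i⟩] := by
      refine .ofLocal (by simpa only [add_assoc] using LocalIsotopy.height x y i (b + j)) ?_ ?_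
      · exact ⟨b + (j + y.inp + c), by simp only; omega, c, by simp only; omega,
          by simp only [Stacks]; omega⟩
      · exact ⟨c, by simp only; omega, b + (j + y.out + c), by simp only; omega,
          by simp only [Stacks]; omega⟩
    have h2 := h1.comp_right (hw.shift (i + x.out + b))
    have h3 : Stacks (i + x.inp + b + (j + y.inp + c)) [⟨y, i + x.inp + b + j⟩]
        (i + x.inp + b + (j + y.out + c)) :=
      ⟨c, by simp only; omega, by simp only [Stacks]; omega⟩
    exact h2.trans (comp_left h3 (ih hw))

/-- Drawings side by side may be moved past each other. -/
theorem interchange {n m p q : ℕ} {v w : List Layer} (hv : Stacks n v m) (hw : Stacks p w q) :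
    Iso (n + p) (m + q) (v ++ BraidedBand.shift m w) (BraidedBand.shift n w ++ v) := by
  induction v generalizing n with
  | nil =>
    obtain rfl : n = m := hv
    exact (Iso.refl (hw.shift n)).cast
  | cons x v ih =>
    obtain ⟨b, rfl, hv⟩ := hv
    have hx : Stacks (x.pos + x.piece.inp + b) [x] (x.pos + x.piece.out + b) := ⟨b, rfl, rfl⟩
    have h1 := comp_left (hx.pad p) (ih hv)
    have h2 := (interchange_layer x hx hw).comp_right (hv.pad q)
    simpa using h1.trans (by simpa using h2)

end Iso

/-! ### Crossings of cables and their naturality. -/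

/-- One band crosses the `n` bands to its right. -/
def strand (e : Bool) (n : ℕ) : List Layer := (List.range n).map fun i => cross e i

theorem strand_add (e : Bool) (n p : ℕ) : strand e (n + p) = strand e n ++ shift n (strand e p) := by
  simp [strand, shift, List.range_add, Function.comp_def]

theorem stacks_strand (e : Bool) (n : ℕ) : Stacks (1 + n) (strand e n) (n + 1) := by
  induction n with
  | zero => rfl
  | succ n ih =>
    rw [strand_add]
    refine (ih.pad 1).append ?_
    exact ⟨0, by simp [Piece.inp], by simp [Stacks, Piece.out]⟩

/-- The `m` leftmost bands cross the `n` bands to their right. -/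
def cable (e : Bool) : ℕ → ℕ → List Layer
  | 0, _ => []
  | m + 1, n => shift 1 (cable e m n) ++ strand e n

theorem stacks_cable (e : Bool) (m n : ℕ) : Stacks (m + n) (cable e m n) (n + m) := by
  induction m with
  | zero => simp [cable, Stacks]
  | succ m ih =>
    have h1 := ih.shift 1
    have h2 := (stacks_strand e n).pad m
    rw [show 1 + (m + n) = m + 1 + n by omega, show 1 + (n + m) = 1 + n + m by omega] at h1
    rw [show n + 1 + m = n + (m + 1) by omega] at h2
    exact h1.append h2

@[simp] theorem cable_zero_right (e : Bool) (m : ℕ) : cable e m 0 = [] := by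
  induction m with
  | zero => rfl
  | succ m ih => simp [cable, ih, strand]

/-- An equality of words, because `cable` recurses on the left block; cutting the right block in two
needs an isotopy, see `cable_add_right`. -/
theorem cable_add_left (e : Bool) (m p n : ℕ) :
    cable e (m + p) n = shift m (cable e p n) ++ cable e m n := by
  induction m with
  | zero => simp [cable]
  | succ m ih => rw [Nat.add_right_comm]; simp [cable, ih, add_comm 1 m]

/-- Crossing two neighbouring cables means crossing one after the other. -/
theorem cable_add_right (e : Bool) (m n p : ℕ) :
    Iso (m + (n + p)) (n + p + m) (cable e m (n + p)) (cable e m n ++ shift n (cable e m p)) := by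
  induction m with
  | zero => exact (Iso.refl (stacks_cable e 0 (n + p))).congr_right (by simp [cable])
  | succ m ih =>
    refine ((((Iso.refl (stacks_cable e (m + 1) (n + p))).step ih 1 0 [] (strand e (n + p))
      (by simp [Stacks]; omega) rfl).step
      (Iso.interchange (stacks_strand e n) (stacks_cable e m p)).symm 0 0 (shift 1 (cable e m n))
      (shift n (strand e p)) ?_ ?_).congr_right ?_)
    · exact (((stacks_cable e m n).shift 1).pad p).cast
    · simp [strand_add, add_comm]
    · simp [cable]

theorem cross_cross_iso (e : Bool) : Iso 2 2 [cross e 0, cross (!e) 0] [] :=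
  .ofLocal (.cancel e 0) ⟨0, rfl, 0, rfl, rfl⟩ rfl

/-- The crossings are nested: the first crossing of the strand and the last one of its return are an
inverse pair once everything between them has cancelled. -/
theorem strand_cancel (e : Bool) (n : ℕ) :
    Iso (1 + n) (1 + n) (strand e n ++ cable (!e) n 1) [] := by
  induction n with
  | zero => exact .refl rfl
  | succ n ih =>
    have h0 : Stacks (1 + (n + 1)) (strand e (n + 1) ++ cable (!e) (n + 1) 1) (1 + (n + 1)) :=
      (stacks_strand e (n + 1)).append ((stacks_cable (!e) (n + 1) 1).cast)
    refine (((Iso.refl h0).step ih 1 0 [cross e 0] [cross (!e) 0] ?_ ?_).step (cross_cross_iso e)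
      0 n [] [] ?_ ?_).congr_right ?_
    · exact ⟨n, by simp [Piece.inp]; omega, by simp [Stacks, Piece.out]; omega⟩
    · rw [add_comm n 1, strand_add, add_comm 1 n]
      simp [cable, strand]
    · simp [Stacks]; omega
    · simp
    · simp

/-- A crossing of cables followed by the inverse crossing is trivial. -/
theorem cable_cancel (e : Bool) (m n : ℕ) :
    Iso (m + n) (m + n) (cable e m n ++ cable (!e) n m) [] := by
  induction m with
  | zero =>
    have h : Stacks (0 + n) [] (0 + n) := rfl
    exact ((Iso.refl h).congr_right (by simp [cable])).symm
  | succ m ih =>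
    refine (((((Iso.refl ((stacks_cable e (m + 1) n).append
      ((stacks_cable (!e) n (m + 1))))).step (cable_add_right (!e) n 1 m) 0 0
      (cable e (m + 1) n) [] ?_ ?_).step (strand_cancel e n) 0 m (shift 1 (cable e m n))
      (shift 1 (cable (!e) n m)) ?_ ?_).step ih 1 0 [] [] ?_ ?_).congr_right ?_).cast
      (hv := rfl) (hw := rfl)
    · exact (stacks_cable e (m + 1) n).cast
    · simp [add_comm]
    · exact ((stacks_cable e m n).shift 1).cast
    · simp [cable]
    · simp [Stacks]; omega
    · simp
    · simp

/-- For splits and merges this is a defining relation, for a crossing of the same sign the braid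
relation. The mixed-sign braid relation has to be derived. -/
theorem strand_piece (e : Bool) (x : Piece) :
    Iso (1 + x.inp) (x.out + 1) (strand e x.inp ++ [⟨x, 0⟩]) (⟨x, 1⟩ :: strand e x.out) := by
  cases x with
  | split =>
    exact .ofLocal (.splitLeft e 0) ⟨0, rfl, 1, rfl, rfl⟩ ⟨0, rfl, 1, rfl, 0, rfl, rfl⟩
  | merge =>
    exact .symm (.ofLocal (.mergeLeft e 0) ⟨0, rfl, 0, rfl, rfl⟩ ⟨1, rfl, 0, rfl, 1, rfl, rfl⟩)
  | cross f =>
    have hs : ∀ {f : Bool} {i : ℕ}, i < 2 → Stacks 3 [cross f i] 3 := by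
      intro f i hi
      exact ⟨1 - i, by simp [Piece.inp]; omega, by simp [Stacks, Piece.out]; omega⟩
    have hb : ∀ f : Bool, Iso 3 3 [cross f 0, cross f 1, cross f 0]
        [cross f 1, cross f 0, cross f 1] := fun f =>
      .ofLocal (.braid f 0) ⟨1, rfl, 0, rfl, 1, rfl, rfl⟩ ⟨0, rfl, 1, rfl, 0, rfl, rfl⟩
    by_cases hf : f = e
    · subst hf
      exact hb f
    · obtain rfl : f = !e := by cases e <;> cases f <;> simp_all
      have c0 : Iso 3 3 [cross e 0, cross (!e) 0] [] := (cross_cross_iso e).pad 1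
      have c1 : Iso 3 3 [cross (!e) 1, cross e 1] [] := by
        simpa using (cross_cross_iso (!e)).shift 1
      have h01 : Stacks 3 [cross e 0, cross e 1] 3 := (hs (by omega)).append (hs (by omega))
      -- Insert an inverse pair at position 1 in front, apply the braid relation to the three
      -- crossings of sign `e`, and cancel the inverse pair created at the end.
      have h1 := (c1.comp_right (h01.append (hs (f := !e) (i := 0) (by omega)))).symm
      have h2 := ((hb e).symm.comp_left (hs (f := !e) (i := 1) (by omega))).comp_right
        (hs (f := !e) (i := 0) (by omega))
      have h3 := c0.comp_left ((hs (f := !e) (i := 1) (by omega)).append h01)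
      exact h1.trans (h2.trans h3)

theorem stacks_piece (x : Piece) : Stacks x.inp [⟨x, 0⟩] x.out := ⟨0, by simp, by simp [Stacks]⟩

theorem stacks_layer (x : Piece) (j r : ℕ) : Stacks (j + x.inp + r) [⟨x, j⟩] (j + x.out + r) :=
  ⟨r, rfl, rfl⟩

/-- A band may be pushed across a drawing. -/
theorem strand_natural (e : Bool) {a b : ℕ} {w : List Layer} (hw : Stacks a w b) :
    Iso (1 + a) (b + 1) (strand e a ++ w) (shift 1 w ++ strand e b) := by
  induction w generalizing a with
  | nil =>
    obtain rfl : a = b := hw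
    exact (Iso.refl (stacks_strand e a)).cast
  | cons x w ih =>
    obtain ⟨x, j⟩ := x
    obtain ⟨r, rfl, hw⟩ := hw
    simp only at hw ⊢
    have h0 : Stacks (1 + (j + x.inp + r)) (strand e (j + x.inp + r) ++ ⟨x, j⟩ :: w) (b + 1) :=
      (stacks_strand e _).append (Stacks.pad (((stacks_layer x j r).append hw)) 1)
    -- The strand is cut into the crossings left of the piece, those with its inputs and those right
    -- of it. The piece slides past the third group, through the second by `strand_piece`, and past
    -- the first.
    refine ((((((Iso.refl h0).step (Iso.interchange (stacks_piece x) (stacks_strand e r)).symm j 0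
      (strand e j ++ shift j (strand e x.inp)) w ?_ ?_).step (strand_piece e x) j r
      (strand e j) (shift (j + x.out) (strand e r) ++ w) ?_ ?_).step
      (Iso.interchange (stacks_strand e j) (stacks_piece x)) 0 r []
      (shift j (strand e x.out) ++ shift (j + x.out) (strand e r) ++ w) ?_ ?_).step (ih hw) 0 0
      [⟨x, 1 + j⟩] [] ?_ ?_).congr_right ?_)
    · refine Stacks.append (k := j + 1 + x.inp + r) ((stacks_strand e j).pad (x.inp + r)).cast ?_
      exact (((stacks_strand e x.inp).shift j).pad r).cast
    · simp [strand_add]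
    · exact ((stacks_strand e j).pad (x.inp + r)).cast
    · simp
    · simp [Stacks]; omega
    · simp [add_comm]
    · exact ((stacks_layer x j r).shift 1).cast
    · simp [strand_add, add_comm 1 j]
    · simp

theorem cable_natural_right (e : Bool) (m : ℕ) {a b : ℕ} {w : List Layer} (hw : Stacks a w b) :
    Iso (m + a) (b + m) (cable e m a ++ w) (shift m w ++ cable e m b) := by
  induction m with
  | zero =>
    exact (Iso.refl (hw.cast (n' := 0 + a) (m' := b + 0))).congr_right (by simp [cable])
  | succ m ih =>
    have h0 : Stacks (m + 1 + a) (cable e (m + 1) a ++ w) (b + (m + 1)) :=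
      (stacks_cable e (m + 1) a).append (hw.pad (m + 1))
    refine (((Iso.refl h0).step (strand_natural e hw) 0 m (shift 1 (cable e m a)) [] ?_ ?_).step
      ih 1 0 [] (strand e b) ?_ ?_).congr_right ?_
    · exact ((stacks_cable e m a).shift 1).cast
    · simp [cable]
    · simp [Stacks]; omega
    · simp
    · simp [cable, add_comm]

/-- Obtained from `cable_natural_right` for the inverse crossing: append a cable crossing together
with its inverse, slide `w` through the inverse, then cancel at the top. -/
theorem cable_natural_left (e : Bool) (n : ℕ) {a b : ℕ} {w : List Layer} (hw : Stacks a w b) :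
    Iso (a + n) (n + b) (cable e a n ++ shift n w) (w ++ cable e b n) := by
  have h0 : Stacks (a + n) (cable e a n ++ shift n w) (n + b) :=
    (stacks_cable e a n).append (hw.shift n)
  have hc : Iso (n + b) (n + b) (cable (!e) n b ++ cable e b n) [] := by
    simpa using cable_cancel (!e) n b
  refine (((Iso.refl h0).step hc.symm 0 0 (cable e a n ++ shift n w) [] ?_ ?_).step
    (cable_natural_right (!e) n hw).symm 0 0 (cable e a n) (cable e b n) ?_ ?_).step
    (cable_cancel e a n) 0 0 [] (w ++ cable e b n) ?_ ?_ |>.congr_right ?_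
  · exact h0.cast
  · simp
  · exact (stacks_cable e a n).cast
  · simp
  · simp [Stacks]
  · simp
  · simp

/-! ### Labelled drawings and their expansions by widths. -/

/-- Elementary pieces whose bands carry labels: `split x y z` splits `x` into `y` and `z`,
`merge y z x` merges `y` and `z` into `x`, and `cross e x y` takes `x`, `y` to `y`, `x`. -/
inductive LPiece (L : Type*) : Type _
  | split (x y z : L) : LPiece L
  | merge (y z x : L) : LPiece L
  | cross (e : Bool) (x y : L) : LPiece L

/-- A layer of a labelled drawing, together with the labels of the bands to the left of its piece. -/
structure LLayer (L : Type*) : Type _ where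
  left : List L
  piece : LPiece L

variable {L : Type*}

namespace LPiece

/-- The labels at the top of a piece. -/
def inp : LPiece L → List L
  | split x _ _ => [x]
  | merge y z _ => [y, z]
  | cross _ x y => [x, y]

/-- The labels at the bottom of a piece. -/
def out : LPiece L → List L
  | split _ y z => [y, z]
  | merge _ _ x => [x]
  | cross _ x y => [y, x]

/-- The underlying piece. -/
def forget : LPiece L → Piece
  | split _ _ _ => .split
  | merge _ _ _ => .merge
  | cross e _ _ => .cross e

/-- Splits and merges are vertices, crossings are not. -/
def isVertex : LPiece L → Bool
  | cross _ _ _ => false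
  | _ => true

@[simp] theorem inp_length (p : LPiece L) : p.inp.length = p.forget.inp := by cases p <;> rfl

@[simp] theorem out_length (p : LPiece L) : p.out.length = p.forget.out := by cases p <;> rfl

end LPiece

/-- `LStacks u w u'`: the layers in `w` form a labelled drawing with labels `u` at the top and `u'`
at the bottom. -/
def LStacks : List L → List (LLayer L) → List L → Prop
  | u, [], u' => u = u'
  | u, x :: w, u' =>
      ∃ b : List L, u = x.left ++ x.piece.inp ++ b ∧ LStacks (x.left ++ x.piece.out ++ b) w u'

theorem lstacks_append {u u' : List L} {v w : List (LLayer L)} :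
    LStacks u (v ++ w) u' ↔ ∃ k, LStacks u v k ∧ LStacks k w u' := by
  induction v generalizing u with
  | nil => simp [LStacks]
  | cons x v ih => simp only [List.cons_append, LStacks, ih]; grind

theorem LStacks.append {u k u' : List L} {v w : List (LLayer L)} (hv : LStacks u v k)
    (hw : LStacks k w u') : LStacks u (v ++ w) u' :=
  lstacks_append.2 ⟨k, hv, hw⟩

theorem LStacks.pad {u u' : List L} {w : List (LLayer L)} (h : LStacks u w u') (b : List L) :
    LStacks (u ++ b) w (u' ++ b) := by
  induction w generalizing u with
  | nil => exact congrArg (· ++ b) h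
  | cons x w ih =>
    obtain ⟨c, rfl, h⟩ := h
    exact ⟨c ++ b, by simp, by simpa using ih h⟩

/-- The drawing underlying a labelled drawing. -/
def forget (w : List (LLayer L)) : List Layer :=
  w.map fun x => ⟨x.piece.forget, x.left.length⟩

/-- The splits and merges in a labelled drawing. -/
def vertices (w : List (LLayer L)) : List (LPiece L) :=
  (w.map LLayer.piece).filter LPiece.isVertex

@[simp] theorem vertices_append (v w : List (LLayer L)) :
    vertices (v ++ w) = vertices v ++ vertices w := by
  simp [vertices]

theorem LStacks.forget {u u' : List L} {w : List (LLayer L)} (h : LStacks u w u') :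
    Stacks u.length (forget w) u'.length := by
  induction w generalizing u with
  | nil => exact congrArg _ h
  | cons x w ih =>
    obtain ⟨c, rfl, h⟩ := h
    exact ⟨c.length, by simp [add_assoc], by simpa [BraidedBand.forget, add_assoc] using ih h⟩

/-- The total width of a list of labelled bands. -/
def width (f : L → ℕ) (u : List L) : ℕ := (u.map f).sum

@[simp] theorem width_nil (f : L → ℕ) : width f [] = 0 := rfl

@[simp] theorem width_cons (f : L → ℕ) (x : L) (u : List L) :
    width f (x :: u) = f x + width f u := by
  simp [width]

@[simp] theorem width_append (f : L → ℕ) (u v : List L) :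
    width f (u ++ v) = width f u + width f v := by
  simp [width]

theorem width_congr {f g : L → ℕ} {u : List L} (h : ∀ x ∈ u, f x = g x) :
    width f u = width g u := by
  simp only [width, List.map_congr_left h]

/-- The drawing by which a vertex of total widths `a` and `b` is replaced. -/
def vertexWord (a b : ℕ) : List Layer :=
  if a = b then [] else if a < b then [split 0] else [merge 0]

theorem stacks_vertexWord {a b : ℕ} (ha : a = 1 ∨ a = 2) (hb : b = 1 ∨ b = 2) :
    Stacks a (vertexWord a b) b := by
  rcases ha with rfl | rfl <;> rcases hb with rfl | rfl
  · rfl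
  · exact ⟨0, rfl, rfl⟩
  · exact ⟨0, rfl, rfl⟩
  · rfl

/-- The drawing of a piece in which the band with label `x` is replaced by `f x` parallel bands. -/
def LPiece.expand (f : L → ℕ) : LPiece L → List Layer
  | cross e x y => cable e (f x) (f y)
  | p => vertexWord (width f p.inp) (width f p.out)

/-- The widths `f` are admissible for `p` if they allow `p` to be replaced by a vertex or by
parallel bands. -/
def LPiece.Adm (f : L → ℕ) (p : LPiece L) : Prop :=
  p.isVertex → (width f p.inp = 1 ∨ width f p.inp = 2) ∧ (width f p.out = 1 ∨ width f p.out = 2)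

theorem LPiece.Adm.stacks_expand {f : L → ℕ} {p : LPiece L} (h : p.Adm f) :
    Stacks (width f p.inp) (p.expand f) (width f p.out) := by
  cases p with
  | split x y z => exact stacks_vertexWord (h rfl).1 (h rfl).2
  | merge x y z => exact stacks_vertexWord (h rfl).1 (h rfl).2
  | cross e x y => exact (stacks_cable e (f x) (f y)).cast (by simp [inp]) (by simp [out])

/-- The drawing in which each band with label `x` is replaced by `f x` parallel bands. -/
def expand (f : L → ℕ) (w : List (LLayer L)) : List Layer :=
  w.flatMap fun x => shift (width f x.left) (x.piece.expand f)

@[simp] theorem expand_nil (f : L → ℕ) : expand f [] = [] := rfl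

@[simp] theorem expand_cons (f : L → ℕ) (x : LLayer L) (w : List (LLayer L)) :
    expand f (x :: w) = shift (width f x.left) (x.piece.expand f) ++ expand f w := rfl

@[simp] theorem expand_append (f : L → ℕ) (v w : List (LLayer L)) :
    expand f (v ++ w) = expand f v ++ expand f w := by
  simp [expand]

/-- The widths `f` are admissible for all vertices in `w`. -/
def Adm (f : L → ℕ) (w : List (LLayer L)) : Prop := ∀ p ∈ vertices w, p.Adm f

theorem adm_append {f : L → ℕ} {v w : List (LLayer L)} :
    Adm f (v ++ w) ↔ Adm f v ∧ Adm f w := by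
  simp [Adm, or_imp, forall_and]

theorem adm_cons {f : L → ℕ} {x : LLayer L} {w : List (LLayer L)} :
    Adm f (x :: w) ↔ x.piece.Adm f ∧ Adm f w := by
  cases h : x.piece.isVertex <;> simp [Adm, vertices, h, LPiece.Adm]

theorem LStacks.expand {f : L → ℕ} {u u' : List L} {w : List (LLayer L)} (h : LStacks u w u')
    (hf : Adm f w) : Stacks (width f u) (expand f w) (width f u') := by
  induction w generalizing u with
  | nil => exact congrArg _ h
  | cons x w ih =>
    obtain ⟨c, rfl, h⟩ := h
    rw [adm_cons] at hf
    have h1 := ((hf.1.stacks_expand.shift (width f x.left)).pad (width f c))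
    exact Stacks.append (h1.cast (by simp [add_assoc]) rfl) ((ih h hf.2).cast (by simp [add_assoc]) rfl)

@[simp] theorem width_one (u : List L) : width (fun _ => 1) u = u.length := by simp [width]

theorem LPiece.expand_one (p : LPiece L) : p.expand (fun _ => 1) = [⟨p.forget, 0⟩] := by
  cases p <;> rfl

theorem expand_one (w : List (LLayer L)) : expand (fun _ => 1) w = forget w := by
  induction w with
  | nil => rfl
  | cons x w ih => simp [ih, LPiece.expand_one, forget]

/-- The elementary isotopies of labelled drawings. -/
inductive LIso : List L → List L → List (LLayer L) → List (LLayer L) → Prop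
  | height (x y : LPiece L) (a c : List L) :
      LIso (a ++ x.inp ++ c ++ y.inp) (a ++ x.out ++ c ++ y.out)
        [⟨a, x⟩, ⟨a ++ x.out ++ c, y⟩] [⟨a ++ x.inp ++ c, y⟩, ⟨a, x⟩]
  | cancel (e : Bool) (a : List L) (x y : L) :
      LIso (a ++ [x, y]) (a ++ [x, y]) [⟨a, .cross e x y⟩, ⟨a, .cross (!e) y x⟩] []
  | braid (e : Bool) (a : List L) (x y z : L) :
      LIso (a ++ [x, y, z]) (a ++ [z, y, x])
        [⟨a, .cross e x y⟩, ⟨a ++ [y], .cross e x z⟩, ⟨a, .cross e y z⟩]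
        [⟨a ++ [x], .cross e y z⟩, ⟨a, .cross e x z⟩, ⟨a ++ [z], .cross e x y⟩]
  | splitRight (e : Bool) (a : List L) (x y p q : L) :
      LIso (a ++ [x, y]) (a ++ [y, p, q])
        [⟨a, .cross e x y⟩, ⟨a ++ [y], .split x p q⟩]
        [⟨a, .split x p q⟩, ⟨a ++ [p], .cross e q y⟩, ⟨a, .cross e p y⟩]
  | splitLeft (e : Bool) (a : List L) (x y p q : L) :
      LIso (a ++ [x, y]) (a ++ [p, q, x])
        [⟨a, .cross e x y⟩, ⟨a, .split y p q⟩]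
        [⟨a ++ [x], .split y p q⟩, ⟨a, .cross e x p⟩, ⟨a ++ [p], .cross e x q⟩]
  | mergeRight (e : Bool) (a : List L) (p q s y : L) :
      LIso (a ++ [p, q, y]) (a ++ [y, s])
        [⟨a, .merge p q s⟩, ⟨a, .cross e s y⟩]
        [⟨a ++ [p], .cross e q y⟩, ⟨a, .cross e p y⟩, ⟨a ++ [y], .merge p q s⟩]
  | mergeLeft (e : Bool) (a : List L) (x p q s : L) :
      LIso (a ++ [x, p, q]) (a ++ [s, x])
        [⟨a ++ [x], .merge p q s⟩, ⟨a, .cross e x s⟩]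
        [⟨a, .cross e x p⟩, ⟨a ++ [p], .cross e x q⟩, ⟨a, .merge p q s⟩]

namespace LIso

theorem perm_vertices {s t : List L} {l r : List (LLayer L)} (h : LIso s t l r) :
    (vertices l).Perm (vertices r) := by
  cases h with
  | height x y a c =>
    simpa [vertices] using (List.Perm.swap y x []).filter LPiece.isVertex
  | _ => exact List.Perm.refl _

theorem lstacks {s t : List L} {l r : List (LLayer L)} (h : LIso s t l r) :
    LStacks s l t ∧ LStacks s r t := by
  cases h with
  | height x y a c =>
    exact ⟨⟨c ++ y.inp, by simp, [], by simp, by simp [LStacks]⟩,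
      [], by simp, c ++ y.out, by simp, by simp [LStacks]⟩
  | _ => simp [LStacks, LPiece.inp, LPiece.out]

/-- Each elementary isotopy expands to an identity for cables: interchange, cancellation, or
naturality of the cable crossing. An expanded vertex is just a partial drawing, so naturality
applies whether it is a split, a merge or empty. -/
theorem expand {f : L → ℕ} {s t : List L} {l r : List (LLayer L)} (h : LIso s t l r)
    (hf : Adm f l) :
    Iso (width f s) (width f t) (expand f l) (expand f r) := by
  have h0 := h.lstacks.1.expand hf
  cases h with
  | height x y a c =>
    simp only [adm_cons] at hf
    refine ((Iso.refl h0).step (Iso.interchange (hf.1.stacks_expand.pad (width f c))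
      hf.2.1.stacks_expand) (width f a) 0 [] [] ?_ ?_).congr_right ?_
    · simp [Stacks]; omega
    · simp
    · simp
  | cancel e a x y =>
    refine ((Iso.refl h0).step (cable_cancel e (f x) (f y)) (width f a) 0 [] [] ?_ ?_).congr_right ?_
    · simp [Stacks]
    · simp [LPiece.expand]
    · simp
  | braid e a x y z =>
    refine ((((Iso.refl h0).step (cable_add_right e (f x) (f y) (f z)).symm (width f a) 0 []
      (BraidedBand.shift (width f a) (cable e (f y) (f z))) ?_ ?_).step
      (cable_natural_right e (f x) (stacks_cable e (f y) (f z))) (width f a) 0 [] [] ?_ ?_).step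
      (cable_add_right e (f x) (f z) (f y)) (width f a) 0
      (BraidedBand.shift (width f a + f x) (cable e (f y) (f z))) [] ?_ ?_).congr_right ?_
    · simp [Stacks]
    · simp [LPiece.expand]
    · simp [Stacks]
    · simp
    · exact ((stacks_cable e (f y) (f z)).shift (width f a + f x)).cast (by simp; omega) (by omega)
    · simp
    · simp [LPiece.expand]
  | splitRight e a x y p q =>
    simp only [adm_cons] at hf
    refine (((Iso.refl h0).step (cable_natural_left e (f y) hf.2.1.stacks_expand) (width f a) 0 []
      [] ?_ ?_).congr_right ?_)
    · simp [Stacks, LPiece.inp]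
    · simp [LPiece.inp, LPiece.expand]
    · simp [LPiece.out, LPiece.expand, cable_add_left]
  | splitLeft e a x y p q =>
    simp only [adm_cons] at hf
    refine ((((Iso.refl h0).step (cable_natural_right e (f x) hf.2.1.stacks_expand) (width f a) 0 []
      [] ?_ ?_).step (cable_add_right e (f x) (f p) (f q)) (width f a) 0
      (BraidedBand.shift (width f a + f x) (LPiece.expand f (.split y p q))) [] ?_ ?_).congr_right ?_)
    · simp [Stacks, LPiece.inp]
    · simp [LPiece.inp, LPiece.expand]
    · exact (hf.2.1.stacks_expand.shift (width f a + f x)).cast (by simp [LPiece.inp]; omega)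
        (by simp [LPiece.out]; omega)
    · simp [LPiece.out]
    · simp [LPiece.expand]
  | mergeRight e a p q s y =>
    simp only [adm_cons] at hf
    refine (((Iso.refl h0).step (cable_natural_left e (f y) hf.1.stacks_expand).symm (width f a) 0 []
      [] ?_ ?_).congr_right ?_)
    · simp [Stacks, LPiece.inp]; omega
    · simp [LPiece.out, LPiece.expand]
    · simp [LPiece.inp, LPiece.expand, cable_add_left]
  | mergeLeft e a x p q s =>
    simp only [adm_cons] at hf
    refine ((((Iso.refl h0).step (cable_natural_right e (f x) hf.1.stacks_expand).symm (width f a) 0 []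
      [] ?_ ?_).step (cable_add_right e (f x) (f p) (f q)) (width f a) 0
      [] (BraidedBand.shift (width f a) (LPiece.expand f (.merge p q s))) ?_ ?_).congr_right ?_)
    · simp [Stacks, LPiece.inp]
    · simp [LPiece.out, LPiece.expand]
    · simp [Stacks]
    · simp [LPiece.inp]
    · simp [LPiece.expand]

end LIso

/-! ### Transport of labels along isotopies. -/

theorem exists_append_of_length {a b s t : List L} (k : ℕ) (h : a ++ s = b ++ t)
    (hl : b.length = a.length + k) : ∃ c, c.length = k ∧ b = a ++ c ∧ s = c ++ t := by
  rcases List.append_eq_append_iff.1 h with ⟨c, rfl, rfl⟩ | ⟨c, rfl, rfl⟩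
  · exact ⟨c, by simpa using hl, rfl, rfl⟩
  · obtain rfl : c = [] := List.eq_nil_of_length_eq_zero (by simp at hl; omega)
    exact ⟨[], by simp at hl; simp [hl], by simp, by simp⟩

theorem eq_append_singleton {a b s t : List L} {x : L} (h : a ++ x :: s = b ++ t)
    (hl : b.length = a.length + 1) : b = a ++ [x] ∧ s = t := by
  have h' : (a ++ [x]) ++ s = b ++ t := by simpa using h
  obtain ⟨h1, h2⟩ := List.append_inj h' (by simp [hl])
  exact ⟨h1.symm, h2⟩

theorem forget_eq_cons {w : List (LLayer L)} {x : Piece} {i : ℕ} {v : List Layer} :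
    forget w = ⟨x, i⟩ :: v ↔ ∃ a p w', w = ⟨a, p⟩ :: w' ∧ p.forget = x ∧ a.length = i ∧
      forget w' = v := by
  simp only [forget, List.map_eq_cons_iff, Layer.mk.injEq]
  constructor
  · rintro ⟨⟨a, p⟩, w', h1, h2, h3⟩
    exact ⟨a, p, w', h1, h2.1, h2.2, h3⟩
  · rintro ⟨a, p, w', h1, h2, h3, h4⟩
    exact ⟨⟨a, p⟩, w', h1, ⟨h2, h3⟩, h4⟩

@[simp] theorem forget_eq_nil {w : List (LLayer L)} : forget w = [] ↔ w = [] := by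
  simp [forget]

theorem LPiece.forget_eq_split {p : LPiece L} :
    p.forget = .split ↔ ∃ x y z, p = .split x y z := by
  cases p <;> simp [forget]

theorem LPiece.forget_eq_merge {p : LPiece L} :
    p.forget = .merge ↔ ∃ x y z, p = .merge x y z := by
  cases p <;> simp [forget]

theorem LPiece.forget_eq_cross {p : LPiece L} {e : Bool} :
    p.forget = .cross e ↔ ∃ x y, p = .cross e x y := by
  cases p <;> simp [forget]

/-- The stacking conditions force the labels of consecutive layers to match, so a labelled left-hand
side has exactly the shape of a left-hand side of `LIso`. The common suffix `b` holds the bands to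
the right. -/
theorem LocalIsotopy.lift_right {l r : List Layer} (h : LocalIsotopy l r) {u u' : List L}
    {v : List (LLayer L)} (hv : forget v = l) (hu : LStacks u v u') :
    ∃ s t b w, u = s ++ b ∧ u' = t ++ b ∧ LIso s t v w ∧ forget w = r := by
  cases h with
  | height x y i d =>
    simp only [forget_eq_cons, forget_eq_nil] at hv
    obtain ⟨a, p, -, rfl, rfl, rfl, a', q, -, rfl, rfl, ha, rfl⟩ := hv
    obtain ⟨c, rfl, c', h, rfl⟩ := hu
    have h' : (a ++ p.out) ++ c = a' ++ (q.inp ++ c') := by simpa using h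
    obtain ⟨c₂, rfl, rfl, rfl⟩ := exists_append_of_length d h' (by simp [ha])
    exact ⟨_, _, c', _, by simp, by simp, .height p q a c₂, by simp [forget, add_assoc]⟩
  | cancel e i =>
    simp only [forget_eq_cons, forget_eq_nil, LPiece.forget_eq_cross] at hv
    obtain ⟨a0, _, -, rfl, ⟨x0, y0, rfl⟩, rfl,
      a1, _, -, rfl, ⟨x1, y1, rfl⟩, h1, rfl⟩ := hv
    obtain ⟨c0, rfl, c1, e1, rfl⟩ := hu
    simp only [LPiece.inp, LPiece.out, List.append_assoc, List.cons_append, List.nil_append] at e1 ⊢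
    obtain ⟨rfl, f1⟩ := List.append_inj e1 h1.symm
    simp only [List.cons.injEq] at f1
    obtain ⟨rfl, rfl, rfl⟩ := f1
    exact ⟨_, _, c0, _, by simp, by simp, .cancel e _ _ _, by simp [forget, LPiece.forget]⟩
  | braid e i =>
    simp only [forget_eq_cons, forget_eq_nil, LPiece.forget_eq_cross] at hv
    obtain ⟨a0, _, -, rfl, ⟨x0, y0, rfl⟩, rfl,
      a1, _, -, rfl, ⟨x1, y1, rfl⟩, h1,
      a2, _, -, rfl, ⟨x2, y2, rfl⟩, h2, rfl⟩ := hv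
    obtain ⟨c0, rfl, c1, e1, c2, e2, rfl⟩ := hu
    simp only [LPiece.inp, LPiece.out, List.append_assoc, List.cons_append, List.nil_append] at e1 e2 ⊢
    obtain ⟨rfl, f1⟩ := eq_append_singleton e1 h1
    simp only [List.cons.injEq] at f1
    obtain ⟨rfl, rfl⟩ := f1
    simp only [List.append_assoc, List.cons_append, List.nil_append] at e2
    obtain ⟨rfl, f2⟩ := List.append_inj e2 h2.symm
    simp only [List.cons.injEq] at f2
    obtain ⟨rfl, rfl, rfl⟩ := f2
    exact ⟨_, _, c1, _, by simp, by simp, .braid e _ _ _ _, by simp [forget, LPiece.forget]⟩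
  | splitRight e i =>
    simp only [forget_eq_cons, forget_eq_nil, LPiece.forget_eq_cross, LPiece.forget_eq_split] at hv
    obtain ⟨a0, _, -, rfl, ⟨x0, y0, rfl⟩, rfl,
      a1, _, -, rfl, ⟨x1, y1, z1, rfl⟩, h1, rfl⟩ := hv
    obtain ⟨c0, rfl, c1, e1, rfl⟩ := hu
    simp only [LPiece.inp, LPiece.out, List.append_assoc, List.cons_append, List.nil_append] at e1 ⊢
    obtain ⟨rfl, f1⟩ := eq_append_singleton e1 h1
    simp only [List.cons.injEq] at f1
    obtain ⟨rfl, rfl⟩ := f1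
    exact ⟨_, _, c0, _, by simp, by simp, .splitRight e _ _ _ _ _, by simp [forget, LPiece.forget]⟩
  | splitLeft e i =>
    simp only [forget_eq_cons, forget_eq_nil, LPiece.forget_eq_cross, LPiece.forget_eq_split] at hv
    obtain ⟨a0, _, -, rfl, ⟨x0, y0, rfl⟩, rfl,
      a1, _, -, rfl, ⟨x1, y1, z1, rfl⟩, h1, rfl⟩ := hv
    obtain ⟨c0, rfl, c1, e1, rfl⟩ := hu
    simp only [LPiece.inp, LPiece.out, List.append_assoc, List.cons_append, List.nil_append] at e1 ⊢
    obtain ⟨rfl, f1⟩ := List.append_inj e1 h1.symm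
    simp only [List.cons.injEq] at f1
    obtain ⟨rfl, rfl⟩ := f1
    exact ⟨_, _, c0, _, by simp, by simp, .splitLeft e _ _ _ _ _, by simp [forget, LPiece.forget]⟩
  | mergeRight e i =>
    simp only [forget_eq_cons, forget_eq_nil, LPiece.forget_eq_cross,
      LPiece.forget_eq_merge] at hv
    obtain ⟨a0, _, -, rfl, ⟨x0, y0, z0, rfl⟩, rfl,
      a1, _, -, rfl, ⟨x1, y1, rfl⟩, h1, rfl⟩ := hv
    obtain ⟨c0, rfl, c1, e1, rfl⟩ := hu
    simp only [LPiece.inp, LPiece.out, List.append_assoc, List.cons_append, List.nil_append] at e1 ⊢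
    obtain ⟨rfl, f1⟩ := List.append_inj e1 h1.symm
    simp only [List.cons.injEq] at f1
    obtain ⟨rfl, rfl⟩ := f1
    exact ⟨_, _, c1, _, by simp, by simp, .mergeRight e _ _ _ _ _, by simp [forget, LPiece.forget]⟩
  | mergeLeft e i =>
    simp only [forget_eq_cons, forget_eq_nil, LPiece.forget_eq_cross,
      LPiece.forget_eq_merge] at hv
    obtain ⟨a0, _, -, rfl, ⟨x0, y0, z0, rfl⟩, h0,
      a1, _, -, rfl, ⟨x1, y1, rfl⟩, rfl, rfl⟩ := hv
    obtain ⟨c0, rfl, c1, e1, rfl⟩ := hu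
    simp only [LPiece.inp, LPiece.out, List.append_assoc, List.cons_append, List.nil_append] at e1 ⊢
    obtain ⟨rfl, f1⟩ := eq_append_singleton e1.symm h0
    simp only [List.cons.injEq] at f1
    obtain ⟨rfl, rfl⟩ := f1
    exact ⟨_, _, c1, _, by simp, by simp, .mergeLeft e _ _ _ _ _, by simp [forget, LPiece.forget]⟩

/-- The converse of `lift_right`. The hypothesis `hl` is needed for `cancel`, where the empty word
does not guarantee that there are two bands to cross. -/
theorem LocalIsotopy.lift_left {l r : List Layer} (h : LocalIsotopy l r) {u u' : List L}
    {v : List (LLayer L)} (hv : forget v = r) (hu : LStacks u v u')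
    (hl : Stacks u.length l u'.length) :
    ∃ s t b w, u = s ++ b ∧ u' = t ++ b ∧ LIso s t w v ∧ forget w = l := by
  cases h with
  | height x y i d =>
    simp only [forget_eq_cons, forget_eq_nil] at hv
    obtain ⟨a', q, -, rfl, rfl, ha, a, p, -, rfl, rfl, rfl, rfl⟩ := hv
    obtain ⟨c', rfl, c, h, rfl⟩ := hu
    have h' : (a ++ p.inp) ++ c = a' ++ (q.out ++ c') := by simpa using h.symm
    obtain ⟨c₂, rfl, rfl, rfl⟩ := exists_append_of_length d h' (by simp [ha])
    exact ⟨_, _, c', _, by simp, by simp, .height p q a c₂, by simp [forget, add_assoc]⟩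
  | cancel e i =>
    obtain rfl := forget_eq_nil.1 hv
    obtain rfl : u = u' := hu
    obtain ⟨k, hk, -⟩ := hl
    obtain ⟨a, t, rfl, rfl⟩ : ∃ a t, u = a ++ t ∧ a.length = i :=
      ⟨u.take i, u.drop i, by simp, by simp [Piece.inp] at hk ⊢; omega⟩
    match t, hk with
    | x :: y :: b, _ =>
      exact ⟨_, _, b, _, by simp, by simp, .cancel e a x y, by simp [forget, LPiece.forget]⟩
    | [], hk => simp [Piece.inp] at hk; omega
    | [x], hk => simp [Piece.inp] at hk; omega
  | braid e i =>
    simp only [forget_eq_cons, forget_eq_nil, LPiece.forget_eq_cross] at hv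
    obtain ⟨a0, _, -, rfl, ⟨x0, y0, rfl⟩, h0,
      a1, _, -, rfl, ⟨x1, y1, rfl⟩, rfl,
      a2, _, -, rfl, ⟨x2, y2, rfl⟩, h2, rfl⟩ := hv
    obtain ⟨c0, rfl, c1, e1, c2, e2, rfl⟩ := hu
    simp only [LPiece.inp, LPiece.out, List.append_assoc, List.cons_append, List.nil_append] at e1 e2 ⊢
    obtain ⟨rfl, f1⟩ := eq_append_singleton e1.symm h0
    simp only [List.cons.injEq] at f1
    obtain ⟨rfl, rfl⟩ := f1
    obtain ⟨rfl, f2⟩ := eq_append_singleton e2 h2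
    simp only [List.cons.injEq] at f2
    obtain ⟨rfl, rfl, rfl⟩ := f2
    exact ⟨_, _, c0, _, by simp, by simp, .braid e _ _ _ _, by simp [forget, LPiece.forget]⟩
  | splitRight e i =>
    simp only [forget_eq_cons, forget_eq_nil, LPiece.forget_eq_cross, LPiece.forget_eq_split] at hv
    obtain ⟨a0, _, -, rfl, ⟨x0, y0, z0, rfl⟩, rfl,
      a1, _, -, rfl, ⟨x1, y1, rfl⟩, h1,
      a2, _, -, rfl, ⟨x2, y2, rfl⟩, h2, rfl⟩ := hv
    obtain ⟨c0, rfl, c1, e1, c2, e2, rfl⟩ := hu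
    simp only [LPiece.inp, LPiece.out, List.append_assoc, List.cons_append, List.nil_append] at e1 e2 ⊢
    obtain ⟨rfl, f1⟩ := eq_append_singleton e1 h1
    simp only [List.cons.injEq] at f1
    obtain ⟨rfl, rfl⟩ := f1
    simp only [List.append_assoc, List.cons_append, List.nil_append] at e2
    obtain ⟨rfl, f2⟩ := List.append_inj e2 h2.symm
    simp only [List.cons.injEq] at f2
    obtain ⟨rfl, rfl, rfl⟩ := f2
    exact ⟨_, _, c1, _, by simp, by simp, .splitRight e _ _ _ _ _, by simp [forget, LPiece.forget]⟩
  | splitLeft e i =>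
    simp only [forget_eq_cons, forget_eq_nil, LPiece.forget_eq_cross, LPiece.forget_eq_split] at hv
    obtain ⟨a0, _, -, rfl, ⟨x0, y0, z0, rfl⟩, h0,
      a1, _, -, rfl, ⟨x1, y1, rfl⟩, rfl,
      a2, _, -, rfl, ⟨x2, y2, rfl⟩, h2, rfl⟩ := hv
    obtain ⟨c0, rfl, c1, e1, c2, e2, rfl⟩ := hu
    simp only [LPiece.inp, LPiece.out, List.append_assoc, List.cons_append, List.nil_append] at e1 e2 ⊢
    obtain ⟨rfl, f1⟩ := eq_append_singleton e1.symm h0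
    simp only [List.cons.injEq] at f1
    obtain ⟨rfl, rfl⟩ := f1
    obtain ⟨rfl, f2⟩ := eq_append_singleton e2 h2
    simp only [List.cons.injEq] at f2
    obtain ⟨rfl, rfl, rfl⟩ := f2
    exact ⟨_, _, c0, _, by simp, by simp, .splitLeft e _ _ _ _ _, by simp [forget, LPiece.forget]⟩
  | mergeRight e i =>
    simp only [forget_eq_cons, forget_eq_nil, LPiece.forget_eq_cross,
      LPiece.forget_eq_merge] at hv
    obtain ⟨a0, _, -, rfl, ⟨x0, y0, rfl⟩, h0,
      a1, _, -, rfl, ⟨x1, y1, rfl⟩, rfl,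
      a2, _, -, rfl, ⟨x2, y2, z2, rfl⟩, h2, rfl⟩ := hv
    obtain ⟨c0, rfl, c1, e1, c2, e2, rfl⟩ := hu
    simp only [LPiece.inp, LPiece.out, List.append_assoc, List.cons_append, List.nil_append] at e1 e2 ⊢
    obtain ⟨rfl, f1⟩ := eq_append_singleton e1.symm h0
    simp only [List.cons.injEq] at f1
    obtain ⟨rfl, rfl⟩ := f1
    obtain ⟨rfl, f2⟩ := eq_append_singleton e2 h2
    simp only [List.cons.injEq] at f2
    obtain ⟨rfl, rfl, rfl⟩ := f2
    exact ⟨_, _, c0, _, by simp, by simp, .mergeRight e _ _ _ _ _, by simp [forget, LPiece.forget]⟩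
  | mergeLeft e i =>
    simp only [forget_eq_cons, forget_eq_nil, LPiece.forget_eq_cross,
      LPiece.forget_eq_merge] at hv
    obtain ⟨a0, _, -, rfl, ⟨x0, y0, rfl⟩, rfl,
      a1, _, -, rfl, ⟨x1, y1, rfl⟩, h1,
      a2, _, -, rfl, ⟨x2, y2, z2, rfl⟩, h2, rfl⟩ := hv
    obtain ⟨c0, rfl, c1, e1, c2, e2, rfl⟩ := hu
    simp only [LPiece.inp, LPiece.out, List.append_assoc, List.cons_append, List.nil_append] at e1 e2 ⊢
    obtain ⟨rfl, f1⟩ := eq_append_singleton e1 h1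
    simp only [List.cons.injEq] at f1
    obtain ⟨rfl, rfl⟩ := f1
    simp only [List.append_assoc, List.cons_append, List.nil_append] at e2
    obtain ⟨rfl, f2⟩ := List.append_inj e2 h2.symm
    simp only [List.cons.injEq] at f2
    obtain ⟨rfl, rfl, rfl⟩ := f2
    exact ⟨_, _, c1, _, by simp, by simp, .mergeLeft e _ _ _ _ _, by simp [forget, LPiece.forget]⟩

theorem Stacks.unique_left {n n' m : ℕ} {w : List Layer} (h : Stacks n w m) (h' : Stacks n' w m) :
    n = n' := by
  induction w generalizing n n' with
  | nil => exact Eq.trans h (Eq.symm h')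
  | cons x w ih =>
    obtain ⟨b, rfl, h⟩ := h
    obtain ⟨b', rfl, h'⟩ := h'
    have := ih h h'
    omega

/-- Labelled drawings with the same vertices all of whose expansions are isotopic. -/
structure Similar (u u' : List L) (v w : List (LLayer L)) : Prop where
  left : LStacks u v u'
  right : LStacks u w u'
  perm : (vertices v).Perm (vertices w)
  iso : ∀ f : L → ℕ, Adm f v → Iso (width f u) (width f u') (expand f v) (expand f w)

namespace Similar

variable {u u' : List L} {v w x : List (LLayer L)}

theorem adm (h : Similar u u' v w) {f : L → ℕ} : Adm f v ↔ Adm f w := by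
  simp only [Adm, h.perm.mem_iff]

theorem refl (h : LStacks u v u') : Similar u u' v v :=
  ⟨h, h, .refl _, fun _ hf => .refl (h.expand hf)⟩

theorem symm (h : Similar u u' v w) : Similar u u' w v :=
  ⟨h.right, h.left, h.perm.symm, fun f hf => (h.iso f (h.adm.2 hf)).symm⟩

theorem trans (h : Similar u u' v w) (h' : Similar u u' w x) : Similar u u' v x :=
  ⟨h.left, h'.right, h.perm.trans h'.perm,
    fun f hf => (h.iso f hf).trans (h'.iso f (h.adm.1 hf))⟩

theorem of_lIso {s t b : List L} {top l r bot : List (LLayer L)} (ht : LStacks u top (s ++ b))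
    (h : LIso s t l r) (hb : LStacks (t ++ b) bot u') :
    Similar u u' (top ++ l ++ bot) (top ++ r ++ bot) where
  left := (ht.append (h.lstacks.1.pad b)).append hb
  right := (ht.append (h.lstacks.2.pad b)).append hb
  perm := by simpa using (h.perm_vertices.append_right _).append_left _
  iso f hf := by
    rw [adm_append, adm_append] at hf
    have h1 := (h.expand hf.1.2).pad (width f b)
    have h2 := h1.comp_right ((hb.expand hf.2).cast (width_append f t b).symm rfl)
    simpa using h2.comp_left ((ht.expand hf.1.1).cast rfl (width_append f s b).symm)

end Similar

theorem Drawing.IsotopyStep.lift {v w : Drawing} (h : v.IsotopyStep w) {u u' : List L}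
    (hu : u.length = 1) (hu' : u'.length = 1) :
    (∀ V, forget V = v.1 → LStacks u V u' → ∃ W, forget W = w.1 ∧ Similar u u' V W) ∧
      ∀ W, forget W = w.1 → LStacks u W u' → ∃ V, forget V = v.1 ∧ Similar u u' W V := by
  obtain ⟨top, l, r, bot, h, hv, hw⟩ := h
  constructor
  · intro V hV hs
    rw [hv, List.append_assoc] at hV
    obtain ⟨T, V, rfl, hT', hV⟩ := List.map_eq_append_iff.1 hV
    obtain ⟨A, B, rfl, hA, hB'⟩ := List.map_eq_append_iff.1 hV
    change forget T = top at hT'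
    change forget A = _ at hA
    change forget B = bot at hB'
    subst hT' hB'
    obtain ⟨k, hT, hs⟩ := lstacks_append.1 hs
    obtain ⟨k', hs, hB⟩ := lstacks_append.1 hs
    obtain ⟨s, t, b, A', rfl, rfl, hi, rfl⟩ := h.lift_right hA hs
    exact ⟨T ++ A' ++ B, by simp [hw, forget], by simpa using Similar.of_lIso hT hi hB⟩
  · intro V hV hs
    rw [hw, List.append_assoc] at hV
    obtain ⟨T, V, rfl, hT', hV⟩ := List.map_eq_append_iff.1 hV
    obtain ⟨A, B, rfl, hA, hB'⟩ := List.map_eq_append_iff.1 hV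
    change forget T = top at hT'
    change forget A = _ at hA
    change forget B = bot at hB'
    subst hT' hB'
    obtain ⟨k, hT, hs⟩ := lstacks_append.1 hs
    obtain ⟨k', hs, hB⟩ := lstacks_append.1 hs
    -- The widths around the replaced piece are determined from the ends: from the top by
    -- `Stacks.unique`, from the bottom by `Stacks.unique_left`.
    have hl : Stacks k.length l k'.length := by
      have h1 := v.2
      rw [hv, List.append_assoc, stacks_append] at h1
      obtain ⟨n, h1, h2⟩ := h1
      obtain ⟨m, h2, h3⟩ := stacks_append.1 h2
      have h4 := hT.forget
      have h5 := hB.forget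
      rw [hu] at h4
      rw [hu'] at h5
      rw [h4.unique h1, h5.unique_left h3]
      exact h2
    obtain ⟨s, t, b, A', rfl, rfl, hi, rfl⟩ := h.lift_left hA hs hl
    exact ⟨T ++ A' ++ B, by simp [hv, forget], by simpa using (Similar.of_lIso hT hi hB).symm⟩

theorem lift_of_toDiagram_eq {v w : Drawing} (h : v.toDiagram = w.toDiagram) {u u' : List L}
    {V : List (LLayer L)} (hu : u.length = 1) (hu' : u'.length = 1) (hV : forget V = v.1)
    (hs : LStacks u V u') : ∃ W, forget W = w.1 ∧ Similar u u' V W := by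
  replace h : Relation.EqvGen Drawing.IsotopyStep v w := Quotient.exact h
  suffices (∀ V, forget V = v.1 → LStacks u V u' → ∃ W, forget W = w.1 ∧ Similar u u' V W) ∧
      ∀ W, forget W = w.1 → LStacks u W u' → ∃ V, forget V = v.1 ∧ Similar u u' W V from
    this.1 V hV hs
  clear hV hs V
  induction h with
  | rel v w h => exact h.lift hu hu'
  | refl v => exact ⟨fun V h hs => ⟨V, h, .refl hs⟩, fun V h hs => ⟨V, h, .refl hs⟩⟩
  | symm v w _ ih => exact ih.symm
  | trans v w x _ _ ih ih' =>
    constructor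
    · intro V hV hs
      obtain ⟨W, hW, h1⟩ := ih.1 V hV hs
      obtain ⟨X, hX, h2⟩ := ih'.1 W hW h1.right
      exact ⟨X, hX, h1.trans h2⟩
    · intro X hX hs
      obtain ⟨W, hW, h1⟩ := ih'.2 X hX hs
      obtain ⟨V, hV, h2⟩ := ih.2 W hW h1.right
      exact ⟨V, hV, h1.trans h2⟩

/-- `Iso` passes through partial drawings, which represent no diagram. The induction therefore runs
over partial drawings completed by arbitrary `top` and `bot`. -/
theorem Iso.toDiagram_eq {v w : Drawing} (h : Iso 1 1 v.1 w.1) : v.toDiagram = w.toDiagram := by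
  suffices key : ∀ {n m : ℕ} {v w : List Layer}, Iso n m v w → ∀ top bot : List Layer,
      Stacks 1 top n → Stacks m bot 1 → ∀ v' w' : Drawing, v'.1 = top ++ v ++ bot →
      w'.1 = top ++ w ++ bot → v'.toDiagram = w'.toDiagram from
    key h [] [] rfl rfl v w (by simp) (by simp)
  intro n m v w h
  induction h with
  | @ofLocal n m l r h _ _ =>
    intro top bot _ _ v' w' hv hw
    exact Quotient.sound (Relation.EqvGen.rel _ _ ⟨top, l, r, bot, h, hv, hw⟩)
  | refl _ =>
    intro top bot _ _ v' w' hv hw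
    exact congrArg _ (Subtype.ext (hv.trans hw.symm))
  | symm _ ih =>
    intro top bot ht hb v' w' hv hw
    exact (ih top bot ht hb w' v' hw hv).symm
  | trans h1 _ ih ih' =>
    intro top bot ht hb v' w' hv hw
    let x : Drawing := ⟨_, (ht.append h1.stacks_both.2).append hb⟩
    exact (ih top bot ht hb v' x hv rfl).trans (ih' top bot ht hb x w' rfl hw)
  | comp h1 h2 ih ih' =>
    intro top bot ht hb v' w' hv hw
    let x : Drawing := ⟨_, ((ht.append h1.stacks_both.2).append h2.stacks_both.1).append hb⟩
    refine (ih top (_ ++ bot) ht (h2.stacks_both.1.append hb) v' x (by simp [hv]) (by simp [x])).trans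
      (ih' (top ++ _) bot (ht.append h1.stacks_both.2) hb x w' (by simp [x]) (by simp [hw]))

/-! ### Births and deaths of labels. -/

/-- The labels of the bands that start at a vertex of `w`. -/
def births (w : List (LLayer L)) : List L := (vertices w).flatMap LPiece.out

/-- The labels of the bands that end at a vertex of `w`. -/
def deaths (w : List (LLayer L)) : List L := (vertices w).flatMap LPiece.inp

@[simp] theorem births_append (v w : List (LLayer L)) :
    births (v ++ w) = births v ++ births w := by simp [births]

@[simp] theorem deaths_append (v w : List (LLayer L)) :
    deaths (v ++ w) = deaths v ++ deaths w := by simp [deaths]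

theorem births_singleton (a : List L) (p : LPiece L) :
    births [⟨a, p⟩] = if p.isVertex then p.out else [] := by
  cases p <;> rfl

theorem deaths_singleton (a : List L) (p : LPiece L) :
    deaths [⟨a, p⟩] = if p.isVertex then p.inp else [] := by
  cases p <;> rfl

theorem inp_births_perm (a : List L) (p : LPiece L) :
    (p.inp ++ births [⟨a, p⟩]).Perm (p.out ++ deaths [⟨a, p⟩]) := by
  rw [births_singleton, deaths_singleton]
  cases p with
  | split x y z => exact List.perm_append_comm
  | merge x y z => exact List.perm_append_comm
  | cross e x y => exact List.Perm.swap y x []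

/-- Conservation of bands: each one starts at the top or at a vertex and ends at the bottom or at a
vertex. Hence distinctness of births yields distinctness of deaths. -/
theorem LStacks.perm {u u' : List L} {w : List (LLayer L)} (h : LStacks u w u') :
    (u ++ births w).Perm (u' ++ deaths w) := by
  classical
  induction w generalizing u with
  | nil => obtain rfl : u = u' := h; exact .refl _
  | cons x w ih =>
    obtain ⟨b, rfl, h⟩ := h
    have h1 := ih h
    have h2 : (x.piece.inp ++ births [x]).Perm (x.piece.out ++ deaths [x]) :=
      inp_births_perm x.left x.piece
    rw [← List.singleton_append, births_append, deaths_append]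
    rw [List.perm_iff_count] at *
    intro a
    have h1 := h1 a
    have h2 := h2 a
    simp only [List.count_append] at *
    omega

/-- The labels that occur in a layer. -/
def LLayer.labels (x : LLayer L) : List L := x.left ++ x.piece.inp ++ x.piece.out

theorem LStacks.labels_subset_births {u u' : List L} {w : List (LLayer L)} (h : LStacks u w u') :
    ∀ x ∈ w, x.labels ⊆ u ++ births w := by
  induction w generalizing u with
  | nil => simp
  | cons x w ih =>
    obtain ⟨b, rfl, h⟩ := h
    have h2 : x.piece.out ⊆ x.piece.inp ++ births [x] := fun a ha =>
      (inp_births_perm x.left x.piece).symm.subset (List.mem_append_left _ ha)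
    rw [← List.singleton_append, births_append]
    intro y hy a ha
    rcases List.mem_append.1 hy with hy | hy
    · obtain rfl := List.mem_singleton.1 hy
      have := @h2 a
      simp only [LLayer.labels, List.mem_append] at *
      tauto
    · have := ih h y hy ha
      have := @h2 a
      simp only [List.mem_append] at *
      tauto

theorem LStacks.labels_subset_deaths {u u' : List L} {w : List (LLayer L)} (h : LStacks u w u') :
    ∀ x ∈ w, x.labels ⊆ u' ++ deaths w := by
  induction w generalizing u with
  | nil => simp
  | cons x w ih =>
    obtain ⟨b, rfl, h⟩ := h
    have h2 : x.piece.inp ⊆ x.piece.out ++ deaths [x] := fun a ha =>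
      (inp_births_perm x.left x.piece).subset (List.mem_append_left _ ha)
    have h3 : x.left ++ x.piece.out ++ b ⊆ u' ++ deaths w := fun a ha =>
      h.perm.subset (List.mem_append_left _ ha)
    rw [← List.singleton_append, deaths_append]
    intro y hy a ha
    rcases List.mem_append.1 hy with hy | hy
    · obtain rfl := List.mem_singleton.1 hy
      have := @h2 a
      have := @h3 a
      simp only [LLayer.labels, List.mem_append] at *
      tauto
    · have := ih h y hy ha
      simp only [List.mem_append] at *
      tauto

theorem expand_congr {f g : L → ℕ} {w : List (LLayer L)} (h : ∀ x ∈ w, ∀ a ∈ x.labels, f a = g a) :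
    expand f w = expand g w := by
  refine List.flatMap_congr fun x hx => ?_
  have h := h x hx
  simp only [LLayer.labels, List.mem_append] at h
  rw [width_congr fun a ha => h a (by simp [ha])]
  congr 1
  obtain ⟨a, p⟩ := x
  have h1 : width f p.inp = width g p.inp := width_congr fun a ha => h a (by simp [ha])
  have h2 : width f p.out = width g p.out := width_congr fun a ha => h a (by simp [ha])
  cases p with
  | split x y z => simp only [LPiece.expand, h1, h2]
  | merge x y z => simp only [LPiece.expand, h1, h2]
  | cross e x y => simp only [LPiece.expand]; rw [h x (by simp [LPiece.inp]), h y (by simp [LPiece.inp])]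

theorem LPiece.eq_of_mem {g : LPiece L → List L} {l : List (LPiece L)} (hl : (l.flatMap g).Nodup)
    {p q : LPiece L} (hp : p ∈ l) (hq : q ∈ l) {a : L} (ha : a ∈ g p) (ha' : a ∈ g q) : p = q := by
  by_contra hpq
  have h := (List.nodup_flatMap.1 hl).2
  have : Std.Symm (Function.onFun List.Disjoint g) := ⟨fun _ _ h => h.symm⟩
  exact h.forall hp hq hpq ha ha'

/-- Every drawing can be labelled such that different bands have different labels. -/
theorem exists_labelling {w : List Layer} {n m : ℕ} (h : Stacks n w m) (u : List ℕ)
    (hu : u.length = n) (k : ℕ) :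
    ∃ u' W, LStacks u W u' ∧ forget W = w ∧ (births W).Nodup ∧ ∀ x ∈ births W, k ≤ x := by
  induction w generalizing n u k with
  | nil => exact ⟨u, [], rfl, rfl, by simp [births, vertices], by simp [births, vertices]⟩
  | cons x w ih =>
    obtain ⟨x, i⟩ := x
    obtain ⟨b, rfl, h⟩ := h
    simp only at h hu
    obtain ⟨a, t, rfl, rfl⟩ : ∃ a t, u = a ++ t ∧ a.length = i :=
      ⟨u.take i, u.drop i, by simp, by simp; omega⟩
    obtain ⟨c, d, rfl, hc⟩ : ∃ c d, t = c ++ d ∧ c.length = x.inp :=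
      ⟨t.take x.inp, t.drop x.inp, by simp, by simp at hu ⊢; omega⟩
    obtain ⟨p, rfl, rfl, hp, hk⟩ : ∃ p : LPiece ℕ, p.forget = x ∧ p.inp = c ∧
        (births [⟨a, p⟩]).Nodup ∧ ∀ y ∈ births [⟨a, p⟩], k ≤ y ∧ y < k + 2 := by
      simp only [births_singleton]
      cases x with
      | split =>
        obtain ⟨x, rfl⟩ := List.length_eq_one_iff.1 hc
        exact ⟨.split x k (k + 1), rfl, rfl, by simp [LPiece.isVertex, LPiece.out],
          by simp [LPiece.isVertex, LPiece.out]⟩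
      | merge =>
        obtain ⟨x, y, rfl⟩ := List.length_eq_two.1 hc
        exact ⟨.merge x y k, rfl, rfl, by simp [LPiece.isVertex, LPiece.out],
          by simp [LPiece.isVertex, LPiece.out]⟩
      | cross e =>
        obtain ⟨x, y, rfl⟩ := List.length_eq_two.1 hc
        exact ⟨.cross e x y, rfl, rfl, by simp [LPiece.isVertex], by simp [LPiece.isVertex]⟩
    obtain ⟨u', W, hs, rfl, hn, hW⟩ := ih h (a ++ p.out ++ d) (by simp at hu ⊢; omega) (k + 2)
    refine ⟨u', [⟨a, p⟩] ++ W, LStacks.append (v := [⟨a, p⟩]) ⟨d, by simp, rfl⟩ hs, by simp [forget], ?_, ?_⟩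
    · rw [births_append, List.nodup_append]
      refine ⟨hp, hn, fun y hy z hz => ?_⟩
      have := hk y hy
      have := hW z hz
      omega
    · rw [births_append]
      intro y hy
      rcases List.mem_append.1 hy with hy | hy
      · exact (hk y hy).1
      · have := hW y hy
        omega

/-! ### Removal of eyes and joints as a change of width. -/

/-- `Eyelet p q s k`: the vertex `p` directly followed by `q` is an eye or a joint, which is removed
by giving width `k` to the band `s`. -/
inductive Eyelet : LPiece L → LPiece L → L → ℕ → Prop
  | eye (x y z w : L) : Eyelet (.split x y z) (.merge y z w) y 0
  | joint (p q x y z : L) : Eyelet (.merge p q x) (.split x y z) x 2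

/-- The widths of the bands at a vertex which occur when eyes and joints are removed. -/
def LPiece.Good (f : L → ℕ) : LPiece L → Prop
  | split x y z => (f x = 1 ∨ f x = 2) ∧ (f y = 0 ∨ f y = 1) ∧ f z = 1
  | merge y z x => (f x = 1 ∨ f x = 2) ∧ (f y = 0 ∨ f y = 1) ∧ f z = 1
  | cross _ _ _ => True

theorem LPiece.Good.adm {f : L → ℕ} {p : LPiece L} (h : p.Good f) : p.Adm f := by
  intro _
  cases p with
  | cross => contradiction
  | _ =>
    obtain ⟨h1, h2, h3⟩ := h
    simp only [inp, out, width_cons, width_nil, h3]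
    omega

/-- The widths `f` are good at all vertices of `w`. -/
def Good (f : L → ℕ) (w : List (LLayer L)) : Prop := ∀ p ∈ vertices w, p.Good f

theorem Good.adm {f : L → ℕ} {w : List (LLayer L)} (h : Good f w) : Adm f w :=
  fun p hp => (h p hp).adm

theorem good_one (w : List (LLayer L)) : Good (fun _ => 1) w := by
  intro p _
  cases p <;> simp [LPiece.Good]

/-- A labelled drawing in which different bands have different labels. -/
structure Labelling (u u' : List L) (w : List (LLayer L)) : Prop where
  lstacks : LStacks u w u'
  nodup : (u ++ births w).Nodup

namespace Labelling

variable {u u' : List L} {w : List (LLayer L)}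

theorem nodup' (h : Labelling u u' w) : (u' ++ deaths w).Nodup :=
  (h.lstacks.perm.nodup_iff).1 h.nodup

theorem eq_of_mem_out (h : Labelling u u' w) {p q : LPiece L} (hp : p ∈ vertices w)
    (hq : q ∈ vertices w) {a : L} (ha : a ∈ p.out) (ha' : a ∈ q.out) : p = q :=
  LPiece.eq_of_mem (List.nodup_append.1 h.nodup).2.1 hp hq ha ha'

theorem eq_of_mem_inp (h : Labelling u u' w) {p q : LPiece L} (hp : p ∈ vertices w)
    (hq : q ∈ vertices w) {a : L} (ha : a ∈ p.inp) (ha' : a ∈ q.inp) : p = q :=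
  LPiece.eq_of_mem (List.nodup_append.1 h.nodup').2.1 hp hq ha ha'

theorem of_similar {v : List (LLayer L)} (h : Labelling u u' w) (hs : Similar u u' w v) :
    Labelling u u' v :=
  ⟨hs.right, ((hs.perm.flatMap_right _).append_left u).nodup_iff.1 h.nodup⟩

theorem eye_ne {T B : List (LLayer L)} {a b : List L} {x y z t : L}
    (h : Labelling u u' (T ++ [⟨a, .split x y z⟩, ⟨b, .merge y z t⟩] ++ B)) : y ≠ z := by
  have := (List.nodup_flatMap.1 (List.nodup_append.1 h.nodup).2.1).1 (.split x y z)
    (by simp [vertices, LPiece.isVertex])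
  simpa [LPiece.out] using this

end Labelling

theorem Eyelet.mem {p q : LPiece L} {s : L} {k : ℕ} (h : Eyelet p q s k) :
    s ∈ p.out ∧ s ∈ q.inp ∧ p.out = q.inp ∧ p.isVertex ∧ q.isVertex := by
  cases h <;> simp [LPiece.inp, LPiece.out, LPiece.isVertex]

theorem Eyelet.expand {p q : LPiece L} {s : L} {k : ℕ} (h : Eyelet p q s k) (a : List L) (f : L → ℕ) :
    BraidedBand.expand f [⟨a, p⟩, ⟨a, q⟩] = shift (width f a)
      (vertexWord (width f p.inp) (width f p.out) ++ vertexWord (width f p.out) (width f q.out)) := by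
  cases h <;> simp [LPiece.expand, LPiece.inp, LPiece.out]

section Update

variable [DecidableEq L] {u u' : List L} {w : List (LLayer L)} {p q : LPiece L} {s : L} {k : ℕ}
  {f : L → ℕ}

/-- Distinctness of labels makes `p` the only vertex where `s` starts and `q` the only one where it
ends. Width 0 thus occurs only on a left band of a vertex, width 2 only on its single band, and the
right band keeps width 1. -/
theorem Good.update (hw : Labelling u u' w) (hp : p ∈ vertices w) (hq : q ∈ vertices w)
    (h : Eyelet p q s k) (hf : Good f w) : Good (Function.update f s k) w := by
  intro r hr
  have hf := hf r hr
  have hout : s ∈ r.out → r = p := fun hs => hw.eq_of_mem_out hr hp hs h.mem.1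
  have hinp : s ∈ r.inp → r = q := fun hs => hw.eq_of_mem_inp hr hq hs h.mem.2.1
  have hn : r.out.Nodup := by
    exact (List.nodup_flatMap.1 (List.nodup_append.1 hw.nodup).2.1).1 r hr
  have hn' : r.inp.Nodup := by
    exact (List.nodup_flatMap.1 (List.nodup_append.1 hw.nodup').2.1).1 r hr
  cases r with
  | cross => trivial
  | split x y z =>
    simp only [LPiece.Good, LPiece.out, LPiece.inp, Function.update_apply, List.mem_cons,
      List.not_mem_nil, or_false, List.nodup_cons] at *
    cases h with
    | eye a _ c d =>
      have : ¬ x = s := fun h => by simpa using hinp h.symm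
      grind
    | joint a b _ d e =>
      have : ¬ (s = y ∨ s = z) := fun h => by simpa using hout h
      grind
  | merge y z x =>
    simp only [LPiece.Good, LPiece.out, LPiece.inp, Function.update_apply, List.mem_cons,
      List.not_mem_nil, or_false, List.nodup_cons] at *
    cases h with
    | eye a _ c d =>
      have : ¬ x = s := fun h => by simpa using hout h.symm
      grind
    | joint a b _ d e =>
      have : ¬ (s = y ∨ s = z) := fun h => by simpa using hinp h
      grind

theorem width_update_of_notMem (hs : s ∉ u) : width (Function.update f s k) u = width f u :=
  width_congr fun _ hx => Function.update_of_ne (ne_of_mem_of_not_mem hx hs) _ _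

/-- The band `s` lives only between `p` and `q`: it is born too late to occur in `T` and dies too
early to occur in `B`. -/
theorem expand_update {T B : List (LLayer L)} {a : List L}
    (hw : Labelling u u' (T ++ [⟨a, p⟩, ⟨a, q⟩] ++ B)) (h : Eyelet p q s k) :
    expand (Function.update f s k) T = expand f T ∧
      expand (Function.update f s k) B = expand f B ∧
      width (Function.update f s k) a = width f a ∧
      width (Function.update f s k) p.inp = width f p.inp ∧
      width (Function.update f s k) q.out = width f q.out ∧
      ∀ x ∈ p.inp, x ∉ q.out := by
  obtain ⟨hp, hq, hpq, hvp, hvq⟩ := h.mem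
  have hn := hw.nodup
  have hn' := hw.nodup'
  obtain ⟨t, ht, hb⟩ := lstacks_append.1 hw.lstacks
  obtain ⟨t, hT, b, rfl, c, hc, rfl⟩ := lstacks_append.1 ht
  have ht' := hT.perm.symm.subset
  replace hT := hT.labels_subset_births
  have hB := hb.labels_subset_deaths
  have h1 : births ([⟨a, p⟩, ⟨a, q⟩] : List (LLayer L)) = p.out ++ q.out := by
    simp [births, vertices, hvp, hvq]
  have h2 : deaths ([⟨a, p⟩, ⟨a, q⟩] : List (LLayer L)) = p.inp ++ q.inp := by
    simp [deaths, vertices, hvp, hvq]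
  simp only [births_append, deaths_append, h1, h2] at hn hn'
  have key : ∀ x, x ∈ u ++ births T → x ∉ p.out ∧ x ∉ q.out := by
    intro x hx
    rw [← List.append_assoc, ← List.append_assoc, List.nodup_append] at hn
    replace hn := hn.1
    rw [List.nodup_append] at hn
    have := hn.2.2 x hx
    constructor
    · exact fun hx => this x (by simp [hx]) rfl
    · exact fun hx => this x (by simp [hx]) rfl
  have key' : ∀ x, x ∈ u' ++ deaths B → x ∉ q.inp := by
    intro x hx hxq
    rcases List.mem_append.1 hx with hx | hx
    · exact (List.nodup_append.1 hn').2.2 x hx x (by simp [hxq]) rfl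
    · exact (List.nodup_append.1 (List.nodup_append.1 hn').2.1).2.2 x (by simp [hxq]) x hx rfl
  have hin : ∀ x, x ∈ a ∨ x ∈ p.inp → x ∈ u ++ births T := fun x hx =>
    ht' (by simp only [List.mem_append]; tauto)
  refine ⟨expand_congr fun x hx y hy => ?_, expand_congr fun x hx y hy => ?_,
    width_update_of_notMem fun hs => ?_, width_update_of_notMem fun hs => ?_,
    width_update_of_notMem fun hs => ?_, fun x hx => (key x (hin x (.inr hx))).2⟩
  · exact Function.update_of_ne (ne_of_mem_of_not_mem hp (key y (hT x hx hy)).1).symm _ _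
  · exact Function.update_of_ne (ne_of_mem_of_not_mem hq (key' y (hB x hx hy))).symm _ _
  · exact (key s (hin s (.inl hs))).1 hp
  · exact (key s (hin s (.inr hs))).1 hp
  · have hd := hb.perm.subset (List.mem_append_left _ (List.mem_append_left _
      (List.mem_append_right _ hs)))
    exact key' s hd hq

theorem shift_vertexWord_redex (i : ℕ) :
    Redex (shift i (vertexWord 1 2 ++ vertexWord 2 1)) ∧
      Redex (shift i (vertexWord 2 1 ++ vertexWord 1 2)) :=
  ⟨.eye i, .joint i⟩

/-- Removing an eye or a joint from an expansion of a drawing is a forward move, unless it does not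
change the expansion at all. -/
theorem expand_update_eq_or_redex {T B : List (LLayer L)} {a : List L}
    (hw : Labelling u u' (T ++ [⟨a, p⟩, ⟨a, q⟩] ++ B)) (h : Eyelet p q s k)
    (hf : Good f (T ++ [⟨a, p⟩, ⟨a, q⟩] ++ B)) (hs : f s = 1)
    (hf1 : ∀ x y, f x ≠ 1 → f y ≠ 1 → x = y) :
    expand (Function.update f s k) (T ++ [⟨a, p⟩, ⟨a, q⟩] ++ B) =
        expand f (T ++ [⟨a, p⟩, ⟨a, q⟩] ++ B) ∨
      ∃ l, Redex l ∧ expand f (T ++ [⟨a, p⟩, ⟨a, q⟩] ++ B) = expand f T ++ l ++ expand f B ∧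
        expand (Function.update f s k) (T ++ [⟨a, p⟩, ⟨a, q⟩] ++ B) =
          expand f T ++ expand f B := by
  obtain ⟨h1, h2, h3, h4, h5, h6⟩ := expand_update (f := f) hw h
  obtain ⟨-, -, -, hvp, hvq⟩ := h.mem
  have hp := hf p (by simp [vertices, hvp])
  have hq := hf q (by simp [vertices, hvq])
  have he := h.expand a f
  have he' := h.expand a (Function.update f s k)
  rw [h3, h4, h5] at he'
  simp only [expand_append, h1, h2]
  rw [he, he']
  cases h with
  | eye x _ z w =>
    have hyz := hw.eye_ne.symm
    -- Joints removed both above and below the eye would involve two labels of width other than 1,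
    -- whereas `f` has at most one.
    have hxw : ¬ (f x = 2 ∧ f w = 2) := fun hh =>
      h6 x (by simp [LPiece.inp]) (by simp [LPiece.out, hf1 x w (by omega) (by omega)])
    simp only [LPiece.Good, LPiece.inp, LPiece.out, width_cons, width_nil, Function.update_self,
      Function.update_of_ne hyz] at *
    rcases hp.1 with hx | hx <;> rcases hq.1 with hw' | hw' <;>
      simp only [hx, hw', hp.2.2, hs] at *
    · exact .inr ⟨_, (shift_vertexWord_redex _).1, rfl, by simp [vertexWord]⟩
    -- An adjacent joint is already removed: a single vertex is left of the overlapping pair, and it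
    -- is the same one after removal of the eye.
    · exact .inl rfl
    · exact .inl rfl
    · simp at hxw
  | joint y z _ y' z' =>
    have hxw : ¬ (f y = 0 ∧ f y' = 0) := fun hh =>
      h6 y (by simp [LPiece.inp]) (by simp [LPiece.out, hf1 y y' (by omega) (by omega)])
    simp only [LPiece.Good, LPiece.inp, LPiece.out, width_cons, width_nil, Function.update_self] at *
    rcases hp.2.1 with hx | hx <;> rcases hq.2.1 with hw' | hw' <;>
      simp only [hx, hw', hp.2.2, hq.2.2, hs] at *
    · simp at hxw
    -- Dually, next to a removed eye the joint has already lost one of its vertices, and widening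
    -- its middle band leaves the same word.
    · exact .inl rfl
    · exact .inl rfl
    · exact .inr ⟨_, (shift_vertexWord_redex _).2, rfl, by simp [vertexWord]⟩

/-- Removing an eye or a joint from a drawing. -/
theorem expand_update_one {T B : List (LLayer L)} {a : List L}
    (hw : Labelling u u' (T ++ [⟨a, p⟩, ⟨a, q⟩] ++ B)) (h : Eyelet p q s k) :
    expand (Function.update (fun _ => 1) s k) (T ++ [⟨a, p⟩, ⟨a, q⟩] ++ B) =
      forget T ++ forget B := by
  obtain ⟨h1, h2, h3, h4, h5, -⟩ := expand_update (f := fun _ => 1) hw h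
  have he := h.expand a (Function.update (fun _ => 1) s k)
  rw [h3, h4, h5] at he
  simp only [expand_append, h1, h2, he, expand_one]
  cases h with
  | eye x _ z w =>
    have hyz := hw.eye_ne
    simp [vertexWord, LPiece.inp, LPiece.out, hyz.symm]
  | joint => simp [vertexWord, LPiece.inp, LPiece.out]

end Update

theorem Redex.exists_eyelet {L : Type*} {l : List Layer} (h : Redex l) {A : List (LLayer L)}
    (hA : forget A = l) {u u' : List L} (hu : LStacks u A u') :
    ∃ a p q s k, A = [⟨a, p⟩, ⟨a, q⟩] ∧ Eyelet p q s k := by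
  cases h with
  | eye i =>
    simp only [forget_eq_cons, forget_eq_nil, LPiece.forget_eq_split, LPiece.forget_eq_merge] at hA
    obtain ⟨a, _, -, rfl, ⟨x, y, z, rfl⟩, rfl, b, _, -, rfl, ⟨y', z', t, rfl⟩, hb, rfl⟩ := hA
    obtain ⟨c, rfl, c', e, rfl⟩ := hu
    simp only [LPiece.inp, LPiece.out, List.append_assoc] at e
    obtain ⟨rfl, f⟩ := List.append_inj e hb.symm
    simp only [List.cons_append, List.nil_append, List.cons.injEq] at f
    obtain ⟨rfl, rfl, rfl⟩ := f
    exact ⟨_, _, _, _, _, rfl, .eye x y z t⟩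
  | joint i =>
    simp only [forget_eq_cons, forget_eq_nil, LPiece.forget_eq_split, LPiece.forget_eq_merge] at hA
    obtain ⟨a, _, -, rfl, ⟨y, z, x, rfl⟩, rfl, b, _, -, rfl, ⟨x', y', z', rfl⟩, hb, rfl⟩ := hA
    obtain ⟨c, rfl, c', e, rfl⟩ := hu
    simp only [LPiece.inp, LPiece.out, List.append_assoc] at e
    obtain ⟨rfl, f⟩ := List.append_inj e hb.symm
    simp only [List.cons_append, List.nil_append, List.cons.injEq] at f
    obtain ⟨rfl, rfl⟩ := f
    exact ⟨_, _, _, _, _, rfl, .joint y z x y' z'⟩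

/-- Ensures that the changed band is not an end of the diagram, so that expansions still have width
1 at top and bottom. -/
theorem Eyelet.notMem {L : Type*} {u u' : List L} {w : List (LLayer L)} {p q : LPiece L} {s : L} {k : ℕ} (h : Eyelet p q s k)
    (hw : Labelling u u' w) (hp : p ∈ vertices w) (hq : q ∈ vertices w) : s ∉ u ∧ s ∉ u' := by
  constructor
  · exact fun hs => (List.nodup_append.1 hw.nodup).2.2 s hs s
      (List.mem_flatMap.2 ⟨p, hp, h.mem.1⟩) rfl
  · exact fun hs => (List.nodup_append.1 hw.nodup').2.2 s hs s
      (List.mem_flatMap.2 ⟨q, hq, h.mem.2.1⟩) rfl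

theorem Eyelet.width_eq {L : Type*} {p q q' : LPiece L} {s s' : L} {k k' : ℕ} (h : Eyelet p q s k)
    (h' : Eyelet p q' s' k') : k = k' := by
  cases h <;> cases h' <;> rfl

theorem Eyelet.mem_vertices {L : Type*} {p q : LPiece L} {s : L} {k : ℕ} (h : Eyelet p q s k)
    (T B : List (LLayer L)) (a : List L) :
    p ∈ vertices (T ++ [⟨a, p⟩, ⟨a, q⟩] ++ B) ∧ q ∈ vertices (T ++ [⟨a, p⟩, ⟨a, q⟩] ++ B) := by
  simp [vertices, h.mem]

theorem exists_eyelet_of_redex {L : Type*} [DecidableEq L] {u u' : List L}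
    {w : List (LLayer L)} {top l bot : List Layer} (hw : Labelling u u' w) (hl : Redex l)
    (h : forget w = top ++ l ++ bot) :
    ∃ T a p q B s k, w = T ++ [⟨a, p⟩, ⟨a, q⟩] ++ B ∧ Eyelet p q s k ∧
      expand (Function.update (fun _ => 1) s k) w = top ++ bot := by
  rw [List.append_assoc] at h
  obtain ⟨T, V, rfl, hT, hV⟩ := List.map_eq_append_iff.1 h
  obtain ⟨A, B, rfl, hA, hB⟩ := List.map_eq_append_iff.1 hV
  change forget T = top at hT
  change forget A = l at hA
  change forget B = bot at hB
  subst hT hB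
  obtain ⟨_, -, hs⟩ := lstacks_append.1 hw.lstacks
  obtain ⟨_, hs, -⟩ := lstacks_append.1 hs
  obtain ⟨a, p, q, s, k, rfl, he⟩ := hl.exists_eyelet hA hs
  rw [← List.append_assoc] at hw ⊢
  exact ⟨T, a, p, q, B, s, k, rfl, he, expand_update_one hw he⟩

/-! ### The diamond property. -/

namespace BraidedBandDiagram

open Relation

theorem reflGen_expand_update {L : Type*} [DecidableEq L] {u u' : List L} {f : L → ℕ}
    {p q : LPiece L} {s : L} {k : ℕ} {T B : List (LLayer L)} {a : List L}
    (hw : Labelling u u' (T ++ [⟨a, p⟩, ⟨a, q⟩] ++ B)) (h : Eyelet p q s k)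
    (hf : Good f (T ++ [⟨a, p⟩, ⟨a, q⟩] ++ B)) (hs : f s = 1)
    (hf1 : ∀ x y, f x ≠ 1 → f y ≠ 1 → x = y) {y z : Drawing}
    (hy : y.1 = expand f (T ++ [⟨a, p⟩, ⟨a, q⟩] ++ B))
    (hz : z.1 = expand (Function.update f s k) (T ++ [⟨a, p⟩, ⟨a, q⟩] ++ B)) :
    ReflGen ForwardMove y.toDiagram z.toDiagram := by
  rcases expand_update_eq_or_redex hw h hf hs hf1 with h1 | ⟨l, hl, h1, h2⟩
  · obtain rfl : z = y := Subtype.ext (hz.trans (h1.trans hy.symm))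
    exact .refl
  · exact .single ⟨y, z, _, l, _, hl, hy.trans h1, hz.trans h2, rfl, rfl⟩

/-- Two forward moves from the same diagram can be completed to a common diagram by at most one
further forward move each. -/
theorem ForwardMove.diamond {D E E' : BraidedBandDiagram} (h : ForwardMove D E)
    (h' : ForwardMove D E') : ∃ F, ReflGen ForwardMove E F ∧ ReflGen ForwardMove E' F := by
  obtain ⟨v, w, top, l, bot, hl, hv, hw, rfl, rfl⟩ := h
  obtain ⟨v', w', top', l', bot', hl', hv', hw', hD, rfl⟩ := h'
  -- The top band is labelled 0, and bands born at vertices get labels from 1 on.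
  obtain ⟨u', V, hs, hV, hn, hpos⟩ := exists_labelling v.2 [0] rfl 1
  have hu' : u'.length = 1 := by
    have := hs.forget
    rw [hV] at this
    exact this.unique v.2
  have hlab : Labelling [0] u' V := ⟨hs, List.nodup_append.2 ⟨by simp, hn, by
    intro x hx y hy
    have := hpos y hy
    simp only [List.mem_singleton] at hx
    omega⟩⟩
  -- The labelling of `v` is transported to `v'`, so that both moves become width changes for one
  -- set of labels.
  obtain ⟨V', hV', hsim⟩ := lift_of_toDiagram_eq hD.symm rfl hu' hV hs
  have hlab' := hlab.of_similar hsim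
  obtain ⟨T, a, p, q, B, s, k, rfl, he, hE⟩ := exists_eyelet_of_redex hlab hl (hV.trans hv)
  obtain ⟨T', a', p', q', B', s', k', rfl, he', hE'⟩ :=
    exists_eyelet_of_redex hlab' hl' (hV'.trans hv')
  rw [← hw] at hE
  rw [← hw'] at hE'
  obtain ⟨hp, hq⟩ := he.mem_vertices T B a
  obtain ⟨hp', hq'⟩ := he'.mem_vertices T' B' a'
  set V := T ++ [⟨a, p⟩, ⟨a, q⟩] ++ B
  set V' := T' ++ [⟨a', p'⟩, ⟨a', q'⟩] ++ B'
  have hsu := he.notMem hlab hp hq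
  have hsu' := he'.notMem hlab' hp' hq'
  have hgood := (good_one V).update hlab hp hq he
  have hgood' := (good_one V').update hlab' hp' hq' he'
  have htr : ∀ f, Good f V ↔ Good f V' := fun f => by simp only [Good, hsim.perm.mem_iff]
  -- If the labels agree, so do the upper vertices, and hence the new widths; both moves are then
  -- expansions by the same widths, in `V` and in `V'`.
  by_cases hss : s = s'
  · subst hss
    obtain rfl : p = p' :=
      hlab'.eq_of_mem_out ((hsim.perm.mem_iff).1 hp) hp' he.mem.1 he'.mem.1
    obtain rfl := he.width_eq he'
    have h1 := hsim.iso _ hgood.adm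
    rw [width_update_of_notMem hsu.1, width_update_of_notMem hsu.2, hE, hE', width_one, width_one,
      hu'] at h1
    exact ⟨_, .refl, by rw [Iso.toDiagram_eq h1]⟩
  · have hgF := hgood'.update hlab' ((hsim.perm.mem_iff).1 hp) ((hsim.perm.mem_iff).1 hq) he
    have hgF₁ := (htr _).2 hgF
    have hcomm := Function.update_comm hss k k' (fun _ : ℕ => 1)
    have hwid : ∀ f : ℕ → ℕ, f = Function.update (fun _ => 1) s k ∨
        f = Function.update (fun _ => 1) s' k' ∨
        f = Function.update (Function.update (fun _ => 1) s' k') s k →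
        width f [0] = 1 ∧ width f u' = 1 := by
      rintro f (rfl | rfl | rfl) <;>
        simp only [width_update_of_notMem hsu.1, width_update_of_notMem hsu.2,
          width_update_of_notMem hsu'.1, width_update_of_notMem hsu'.2, width_one, hu',
          List.length_singleton, and_self]
    have hst : ∀ f : ℕ → ℕ, width f [0] = 1 ∧ width f u' = 1 → Good f V →
        Iso 1 1 (expand f V) (expand f V') := by
      intro f ⟨h1, h2⟩ hg
      have := hsim.iso f hg.adm
      rwa [h1, h2] at this
    have i1 := hst _ (hwid _ (.inl rfl)) hgood
    have i2 := hst _ (hwid _ (.inr (.inl rfl))) ((htr _).2 hgood')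
    have i3 := hst _ (hwid _ (.inr (.inr rfl))) hgF₁
    -- The common target has both widths changed. It is reached from `w` through expansions of `V'`,
    -- where the second redex is visible, and from `w'` through expansions of `V`, where the first
    -- one is.
    let F : Drawing := ⟨_, i3.stacks_both.1⟩
    have hone : ∀ (t : ℕ) (j : ℕ), ∀ x y, Function.update (fun _ => 1) t j x ≠ 1 →
        Function.update (fun _ => 1) t j y ≠ 1 → x = y := by
      intro t j x y hx hy
      by_cases hx' : x = t <;> by_cases hy' : y = t <;> simp_all [Function.update_apply]
    refine ⟨F.toDiagram, ?_, ?_⟩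
    · let y : Drawing := ⟨_, i1.stacks_both.2⟩
      let z : Drawing := ⟨_, i3.stacks_both.2⟩
      have hy : w.toDiagram = y.toDiagram := Iso.toDiagram_eq (by rw [← hE]; exact i1)
      have hz : F.toDiagram = z.toDiagram := Iso.toDiagram_eq i3
      rw [hy, hz]
      exact reflGen_expand_update hlab' he' ((htr _).1 hgood)
        (Function.update_of_ne (Ne.symm hss) _ _) (hone s k) rfl
        (by rw [hcomm])
    · let y : Drawing := ⟨_, i2.stacks_both.1⟩
      have hy : w'.toDiagram = y.toDiagram := Iso.toDiagram_eq (by rw [← hE']; exact i2.symm)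
      rw [hy]
      exact reflGen_expand_update hlab he ((htr _).2 hgood') (Function.update_of_ne hss _ _)
        (hone s' k') rfl rfl

/-! ### Termination. -/

/-- The number of splits and merges in a drawing. -/
def _root_.BraidedBand.vertexCount (w : List Layer) : ℕ :=
  w.countP fun x => x.piece.inp ≠ x.piece.out

theorem _root_.BraidedBand.LocalIsotopy.vertexCount_eq {l r : List Layer} (h : LocalIsotopy l r) :
    vertexCount l = vertexCount r := by
  cases h with
  | height x y i d => simp [vertexCount, List.countP_cons, add_comm]
  | _ => rfl

theorem vertexCount_eq_of_toDiagram_eq {v w : Drawing} (h : v.toDiagram = w.toDiagram) :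
    vertexCount v.1 = vertexCount w.1 := by
  replace h : EqvGen Drawing.IsotopyStep v w := Quotient.exact h
  induction h with
  | rel v w h =>
    obtain ⟨top, l, r, bot, h, hv, hw⟩ := h
    have := h.vertexCount_eq
    simp only [vertexCount] at this
    simp only [hv, hw, vertexCount, List.countP_append, this]
  | refl => rfl
  | symm _ _ _ ih => exact ih.symm
  | trans _ _ _ _ _ ih ih' => exact ih.trans ih'

theorem vertexCount_lt_of_forwardMove {v w : Drawing} (h : ForwardMove v.toDiagram w.toDiagram) :
    vertexCount w.1 < vertexCount v.1 := by
  obtain ⟨v', w', top, l, bot, hl, hv, hw, h, h'⟩ := h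
  rw [← vertexCount_eq_of_toDiagram_eq h, ← vertexCount_eq_of_toDiagram_eq h', hv, hw]
  have : vertexCount l = 2 := by cases hl <;> rfl
  simp only [vertexCount] at this
  simp only [vertexCount, List.countP_append, this]
  omega

theorem exists_reducesTo_isReduced (D : BraidedBandDiagram) : ∃ R, D.ReducesTo R ∧ R.IsReduced := by
  suffices ∀ (n : ℕ) (v : Drawing), vertexCount v.1 = n →
      ∃ R, ReducesTo v.toDiagram R ∧ R.IsReduced by
    induction D using Quotient.inductionOn with
    | h v => exact this _ v rfl
  intro n
  induction n using Nat.strong_induction_on with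
  | h n ih =>
    rintro v rfl
    by_cases hv : IsReduced v.toDiagram
    · exact ⟨_, .refl, hv⟩
    · simp only [IsReduced, not_forall, not_not] at hv
      obtain ⟨E, hE⟩ := hv
      obtain ⟨w, rfl⟩ : ∃ w : Drawing, w.toDiagram = E := Quotient.exists_rep E
      obtain ⟨R, hR, hR'⟩ := ih _ (vertexCount_lt_of_forwardMove hE) w rfl
      exact ⟨R, .head hE hR, hR'⟩

/-! ### Confluence and uniqueness of the reduced diagram. -/

theorem join_of_equivalence {D E : BraidedBandDiagram} (h : equivalence D E) :
    Join ReducesTo D E := by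
  replace h : EqvGen ForwardMove D E := h
  have hJ : Equivalence (Join (ReflTransGen ForwardMove)) :=
    equivalence_join_reflTransGen fun a b c hb hc => by
      obtain ⟨d, hd, hd'⟩ := hb.diamond hc
      exact ⟨d, hd, hd'.to_reflTransGen⟩
  induction h with
  | rel D E h => exact ⟨E, .single h, .refl⟩
  | refl D => exact hJ.refl D
  | symm _ _ _ ih => exact hJ.symm ih
  | trans _ _ _ _ _ ih ih' => exact hJ.trans ih ih'

theorem IsReduced.eq_of_reducesTo {R F : BraidedBandDiagram} (hR : R.IsReduced)
    (h : R.ReducesTo F) : R = F := by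
  rcases ReflTransGen.cases_head h with h | ⟨E, hE, -⟩
  · exact h
  · exact absurd hE (hR E)

/-- A common reduct of `D` and `R` must be `R` itself, as no move leaves `R`. -/
theorem IsReduced.reducesTo_of_equivalence {R D : BraidedBandDiagram} (hR : R.IsReduced)
    (h : equivalence D R) : D.ReducesTo R := by
  obtain ⟨F, hD, hF⟩ := join_of_equivalence h
  rwa [hR.eq_of_reducesTo hF]

end BraidedBandDiagram

end BraidedBand

theorem mainTheorem4 (c : Quotient BraidedBand.BraidedBandDiagram.equivalence) :
    (∃! R : BraidedBand.BraidedBandDiagram,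
      Quotient.mk BraidedBand.BraidedBandDiagram.equivalence R = c ∧ R.IsReduced) ∧
    ∀ R : BraidedBand.BraidedBandDiagram,
      Quotient.mk BraidedBand.BraidedBandDiagram.equivalence R = c → R.IsReduced →
      ∀ D : BraidedBand.BraidedBandDiagram,
        Quotient.mk BraidedBand.BraidedBandDiagram.equivalence D = c → D.ReducesTo R := by
  have key : ∀ R D : BraidedBand.BraidedBandDiagram,
      Quotient.mk BraidedBand.BraidedBandDiagram.equivalence R = c → R.IsReduced →
      Quotient.mk BraidedBand.BraidedBandDiagram.equivalence D = c → D.ReducesTo R :=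
    fun R D hR hr hD => hr.reducesTo_of_equivalence (Quotient.exact (hD.trans hR.symm))
  refine ⟨?_, fun R hR hr D hD => key R D hR hr hD⟩
  induction c using Quotient.inductionOn with
  | h D =>
    obtain ⟨R, hD, hR⟩ := D.exists_reducesTo_isReduced
    have hDR : BraidedBand.BraidedBandDiagram.equivalence R D :=
      Relation.EqvGen.symm _ _ (Relation.EqvGen.reflTransGen_le_eqvGen _ _ _ hD)
    exact ⟨R, ⟨Quotient.sound hDR, hR⟩, fun R' ⟨hR', hr⟩ =>
      hr.eq_of_reducesTo (key R R' (Quotient.sound hDR) hR hR')⟩
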